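/- Let $X(t)$, $t\ge 0$, be an irreducible continuous-time Markov chain on $\{1,\dots,K\}$ with right-continuous paths, arbitrary initial distribution, generator $Q=(q_{ij})$ with strictly negative diagonal entries (so $K\ge 2$), and stationary distribution $\pi$ (a probability vector with $\pi Q=0$). Let $\sigma_i=\sum_{j\ne i}q_{ij}$ be the total exit rate of state $i$. For $\lambda>0$ let the chain be sampled at the points of a Poisson process of intensity $\lambda$ that is independent of $X$. In the fresh-when-sampled model, the binary freshness process $F_s(t)$ is set to $1$ whenever a sample is taken and stays $1$ until the next transition of $X$, at which instant it becomes $0$ and stays $0$ until the next sample; its initial value $F_s(0)\in\{0,1\}$ is an arbitrary random variable. Then, for every $\lambda>0$, the steady-state mean freshness $f(\lambda)=\mathbb{E}[F_s]$ exists, both as the almost sure time average $\lim_{\tau\to\infty}\frac1\tau\int_0^\tau F_s(t)\,dt$ and as the limit $\lim_{t\to\infty}\mathbb{P}[F_s(t)=1]$, and $$f(\lambda)=1-\sum_{i=1}^K\frac{\pi_i\sigma_i}{\lambda+\sigma_i}.$$ Moreover, as a function of $\lambda\in(0,\infty)$, $f$ is strictly increasing and strictly concave, it is differentiable with continuous derivative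 $f'$, and $\lim_{\lambda\to 0^+}f(\lambda)=0$. -/

import Mathlib

open MeasureTheory ProbabilityTheory Filter Topology Set
open scoped NNReal ENNReal

namespace PoissonSampling

/-- `Q` is the infinitesimal generator of a continuous-time Markov chain without absorbing states:
nonnegative transition rates off the diagonal, strictly negative diagonal, zero row sums. -/
structure IsGenerator {K : ℕ} (Q : Matrix (Fin K) (Fin K) ℝ) : Prop where
  offDiag_nonneg : ∀ i j, i ≠ j → 0 ≤ Q i j
  diag_neg : ∀ i, Q i i < 0
  row_sum : ∀ i, ∑ j, Q i j = 0

/-- The total rate `σ_i = ∑_{j ≠ i} q_{ij}` out of state `i`. -/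
def exitRate {K : ℕ} (Q : Matrix (Fin K) (Fin K) ℝ) (i : Fin K) : ℝ :=
  ∑ j ∈ Finset.univ.erase i, Q i j

/-- The transition matrix `exp (t Q)` over a time interval of length `t`. -/
noncomputable def transition {K : ℕ} (Q : Matrix (Fin K) (Fin K) ℝ) (t : ℝ) :
    Matrix (Fin K) (Fin K) ℝ :=
  NormedSpace.exp (t • Q)

/-- Every state can be reached from every state, with positive probability, in some finite time. -/
def IsIrreducible {K : ℕ} (Q : Matrix (Fin K) (Fin K) ℝ) : Prop :=
  ∀ i j, ∃ t : ℝ≥0, 0 < transition Q t i j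

/-- `π` is a stationary distribution: a probability vector with `π Q = 0`. -/
structure IsStationary {K : ℕ} (Q : Matrix (Fin K) (Fin K) ℝ) (π : Fin K → ℝ) : Prop where
  nonneg : ∀ i, 0 ≤ π i
  sum_eq_one : ∑ i, π i = 1
  balance : ∀ j, ∑ i, π i * Q i j = 0

/-- `X` is a continuous-time Markov chain with generator `Q` (and arbitrary initial law): it has
right-continuous paths (for the discrete topology of the state space), and its finite-dimensional
laws are those of the Markov chain with transition matrices `exp (t Q)`. -/
structure IsCTMC {K : ℕ} {Ω : Type*} [MeasurableSpace Ω] (Q : Matrix (Fin K) (Fin K) ℝ)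
    (X : ℝ≥0 → Ω → Fin K) (μ : Measure Ω) : Prop where
  measurable : ∀ t, Measurable (X t)
  rightContinuous : ∀ ω t, ContinuousWithinAt (fun s => X s ω) (Ici t) t
  markov : ∀ (n : ℕ) (t : Fin (n + 1) → ℝ≥0), Monotone t → ∀ x : Fin (n + 1) → Fin K,
    μ.real {ω | ∀ k, X (t k) ω = x k} =
      μ.real {ω | X (t 0) ω = x 0} *
        ∏ k : Fin n, transition Q ((t k.succ : ℝ) - t k.castSucc) (x k.castSucc) (x k.succ)

/-- `N` is (the counting process of) a Poisson process of intensity `lam`. -/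
structure IsPoissonProcess {Ω : Type*} [MeasurableSpace Ω] (lam : ℝ≥0)
    (N : ℝ≥0 → Ω → ℕ) (μ : Measure Ω) : Prop where
  measurable : ∀ t, Measurable (N t)
  zero : ∀ ω, N 0 ω = 0
  monotone : ∀ ω, Monotone (fun t => N t ω)
  rightContinuous : ∀ ω t, ContinuousWithinAt (fun s => N s ω) (Ici t) t
  indepIncrements : HasIndepIncrements N μ
  law : ∀ s t, s ≤ t → μ.map (fun ω => N t ω - N s ω) = poissonMeasure (lam * (t - s))

/-- A Markov source `X` with generator `Q`, sampled at the points of an independent Poisson process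
with counting process `N` and intensity `lam`. -/
structure IsPoissonSampled {K : ℕ} {Ω : Type*} [MeasurableSpace Ω]
    (Q : Matrix (Fin K) (Fin K) ℝ) (lam : ℝ≥0) (X : ℝ≥0 → Ω → Fin K) (N : ℝ≥0 → Ω → ℕ)
    (μ : Measure Ω) : Prop where
  source : IsCTMC Q X μ
  sampler : IsPoissonProcess lam N μ
  indep : IndepFun (fun ω t => X t ω) (fun ω t => N t ω) μ

/-- The path `x` jumps at time `t`. (A right-continuous path never does so at time `0`.) -/
def JumpsAt {S : Type*} [TopologicalSpace S] (x : ℝ≥0 → S) (t : ℝ≥0) : Prop :=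
  ¬ ContinuousAt x t

/-- Freshness at time `t`, for a source path `x`, a path `n` counting the samples, and the
initial freshness bit `b`: either a sample was taken at some time `s ≤ t` and the source has made no
transition in `(s, t]`, or the information was initially fresh and the source has made no transition
in `(0, t]`. -/
def IsFresh {K : ℕ} (x : ℝ≥0 → Fin K) (n : ℝ≥0 → ℕ) (b : Bool) (t : ℝ≥0) : Prop :=
  (∃ s ≤ t, JumpsAt n s ∧ ∀ u ∈ Ioc s t, ¬ JumpsAt x u) ∨
    (b = true ∧ ∀ u ∈ Ioc 0 t, ¬ JumpsAt x u)

open Classical in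
/-- The binary freshness process `F_s(t)` of the fresh-when-sampled model. -/
noncomputable def freshness {K : ℕ} {Ω : Type*} (X : ℝ≥0 → Ω → Fin K) (N : ℝ≥0 → Ω → ℕ)
    (b : Ω → Bool) (t : ℝ≥0) (ω : Ω) : ℝ :=
  if IsFresh (fun s => X s ω) (fun s => N s ω) (b ω) t then 1 else 0

/-- The binary process `F` has mean freshness `m` in the steady state: `m` is the almost sure
long-run time average of `F`, and the limit of the probabilities `ℙ[F(t) = 1]`. -/
structure HasMeanFreshness {Ω : Type*} [MeasurableSpace Ω] (μ : Measure Ω)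
    (F : ℝ≥0 → Ω → ℝ) (m : ℝ) : Prop where
  timeAverage : ∀ᵐ ω ∂μ,
    Tendsto (fun T : ℝ => T⁻¹ * ∫ t in (0 : ℝ)..T, F t.toNNReal ω) atTop (𝓝 m)
  steadyState : Tendsto (fun t : ℝ≥0 => μ.real {ω | F t ω = 1}) atTop (𝓝 m)

end PoissonSampling

/-
Freshness is sampled along a grid of mesh `1 / m`, for an observer who starts stale and treats the
samples taken during a step as taken at its end. Given the past, the probability of being fresh in
state `i` then obeys a one-step linear recursion, and since `exp (t • Q)` converges to its
stationary distribution exponentially fast, the discrete freshness mixes exponentially, at a rate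
that is uniform in the mesh. Its limit `sampledMean` tends to `meanFreshness` as the mesh shrinks,
and right-continuity makes the discrete freshness at the first grid point after `t` eventually equal
to the freshness at `t`, so the mixing estimate passes to continuous time. It gives the limit of the
probabilities at once. It also makes the covariance integrable in the lag, so the time
average up to `T` has mean square deviation `O(1 / T)`; this is summable along `T = n ^ 2`, which
gives almost sure convergence there, and boundedness fills the gaps. The initial bit is forgotten at
the first sample.
-/

namespace PoissonSampling

section RowStochastic

open scoped Matrix Matrix.Norms.Operator
open Matrix (rowStochastic)

variable {n : Type*} [Fintype n] [DecidableEq n] {M P : Matrix n n ℝ}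

theorem pow_apply_nonneg (hM : ∀ i j, 0 ≤ M i j) (k : ℕ) (i j : n) : 0 ≤ (M ^ k) i j := by
  induction k generalizing i j with
  | zero =>
    rw [pow_zero, Matrix.one_apply]
    split_ifs <;> norm_num
  | succ k ih =>
    rw [pow_succ, Matrix.mul_apply]
    exact Finset.sum_nonneg fun l _ => mul_nonneg (ih i l) (hM l j)

theorem hasSum_exp (M : Matrix n n ℝ) :
    HasSum (fun k : ℕ => (k.factorial : ℝ)⁻¹ • M ^ k) (NormedSpace.exp M) :=
  NormedSpace.exp_series_hasSum_exp' (𝕂 := ℝ) M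

theorem one_apply_le_exp_apply (hM : ∀ i j, 0 ≤ M i j) (i j : n) :
    (1 : Matrix n n ℝ) i j ≤ NormedSpace.exp M i j := by
  have hsum := (hasSum_exp M).mapL (Matrix.entryLinearMap ℝ ℝ i j).toContinuousLinearMap
  have hterm : ∀ k : ℕ, k ≠ 0 → 0 ≤ (k.factorial : ℝ)⁻¹ * (M ^ k) i j := fun k _ =>
    mul_nonneg (by positivity) (pow_apply_nonneg hM k i j)
  simpa using le_hasSum hsum 0 hterm

theorem exp_mulVec_eq_self {v : n → ℝ} (h : M *ᵥ v = 0) : NormedSpace.exp M *ᵥ v = v := by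
  have hsum := (hasSum_exp M).mapL ((Matrix.mulVecBilin ℝ ℝ).flip v).toContinuousLinearMap
  refine hsum.unique ?_
  convert hasSum_single (0 : ℕ) fun k hk => ?_
  · simp
  · obtain ⟨k, rfl⟩ := Nat.exists_eq_succ_of_ne_zero hk
    simp [pow_succ, h]

theorem vecMul_exp_eq_self {v : n → ℝ} (h : v ᵥ* M = 0) : v ᵥ* NormedSpace.exp M = v := by
  rw [← Matrix.mulVec_transpose] at h ⊢
  rw [← Matrix.exp_transpose]
  exact exp_mulVec_eq_self h

theorem exp_add_smul_one (M : Matrix n n ℝ) (a : ℝ) :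
    NormedSpace.exp (M + a • (1 : Matrix n n ℝ)) = Real.exp a • NormedSpace.exp M := by
  have hdiag : NormedSpace.exp (a • (1 : Matrix n n ℝ)) = Real.exp a • (1 : Matrix n n ℝ) := by
    simp only [Matrix.smul_one_eq_diagonal, Matrix.exp_diagonal, Pi.exp_def, Real.exp_eq_exp_ℝ]
  rw [Matrix.exp_add_of_commute _ _ ((Commute.one_right M).smul_right a), hdiag,
    Matrix.mul_smul, mul_one]

theorem mulVec_sub_mulVec_le (hP : P ∈ rowStochastic ℝ n) {ε d : ℝ} (hε : ∀ i j, ε ≤ P i j)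
    {v : n → ℝ} (hv : ∀ a b, v a - v b ≤ d) (a b : n) :
    (P *ᵥ v) a - (P *ᵥ v) b ≤ (1 - ε) * d := by
  obtain ⟨m, -, hm⟩ := Finset.exists_min_image Finset.univ v ⟨a, Finset.mem_univ a⟩
  have hshift : ∀ i, (P *ᵥ v) i = v m + ∑ j, P i j * (v j - v m) := by
    intro i
    simp only [Matrix.mulVec, dotProduct, mul_sub, Finset.sum_sub_distrib, ← Finset.sum_mul,
      Matrix.sum_row_of_mem_rowStochastic hP]
    ring
  have hlow : 0 ≤ ∑ j, P b j * (v j - v m) := Finset.sum_nonneg fun j hj =>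
    mul_nonneg (Matrix.nonneg_of_mem_rowStochastic hP) (sub_nonneg.2 (hm j hj))
  have hup : ∑ j, P a j * (v j - v m) ≤ (1 - P a m) * d := by
    have hrest : 1 - P a m = ∑ j ∈ Finset.univ.erase m, P a j := by
      rw [← Matrix.sum_row_of_mem_rowStochastic hP a,
        ← Finset.add_sum_erase _ _ (Finset.mem_univ m)]
      ring
    rw [← Finset.add_sum_erase _ _ (Finset.mem_univ m), sub_self, mul_zero, zero_add, hrest,
      Finset.sum_mul]
    exact Finset.sum_le_sum fun j _ =>
      mul_le_mul_of_nonneg_left (hv j m) (Matrix.nonneg_of_mem_rowStochastic hP)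
  have hd : 0 ≤ d := by simpa using hv a a
  linarith [hshift a, hshift b, mul_le_mul_of_nonneg_right (hε a m) hd]

theorem pow_mul_apply_sub_le (hP : P ∈ rowStochastic ℝ n) (hM : M ∈ rowStochastic ℝ n) {ε : ℝ}
    (hε : ∀ i j, ε ≤ P i j) (k : ℕ) (a b i : n) :
    (P ^ k * M) a i - (P ^ k * M) b i ≤ (1 - ε) ^ k := by
  induction k generalizing a b with
  | zero =>
    have h1 := Matrix.le_one_of_mem_rowStochastic hM (i := a) (j := i)
    have h0 := Matrix.nonneg_of_mem_rowStochastic hM (i := b) (j := i)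
    rw [pow_zero, one_mul, pow_zero]
    linarith
  | succ k ih =>
    rw [pow_succ', pow_succ', mul_assoc]
    exact mulVec_sub_mulVec_le hP hε (v := fun j => (P ^ k * M) j i) ih a b

end RowStochastic

theorem abs_sub_sum_mul_le {n : Type*} [Fintype n] {π v : n → ℝ} {d : ℝ}
    (h0 : ∀ i, 0 ≤ π i) (h1 : ∑ i, π i = 1) (hv : ∀ a b, v a - v b ≤ d)
    (a : n) : |v a - ∑ i, π i * v i| ≤ d := by
  have hav : v a - ∑ i, π i * v i = ∑ i, π i * (v a - v i) := by
    simp only [mul_sub, Finset.sum_sub_distrib, ← Finset.sum_mul, h1, one_mul]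
  calc |v a - ∑ i, π i * v i| ≤ ∑ i, |π i * (v a - v i)| :=
        hav ▸ Finset.abs_sum_le_sum_abs _ _
    _ ≤ ∑ i, π i * d := by
        refine Finset.sum_le_sum fun i _ => ?_
        rw [abs_mul, abs_of_nonneg (h0 i)]
        exact mul_le_mul_of_nonneg_left (abs_sub_le_iff.2 ⟨hv a i, hv i a⟩) (h0 i)
    _ = d := by rw [← Finset.sum_mul, h1, one_mul]

theorem pow_floor_le_exp {r : ℝ} (h0 : 0 < r) (h1 : r ≤ 1) (x : ℝ) :
    r ^ ⌊x⌋₊ ≤ r⁻¹ * Real.exp (Real.log r * x) := by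
  have hexp : r⁻¹ * Real.exp (Real.log r * x) = r ^ (x - 1) := by
    rw [Real.rpow_sub_one h0.ne', Real.rpow_def_of_pos h0, div_eq_inv_mul]
  rw [hexp, ← Real.rpow_natCast]
  exact Real.rpow_le_rpow_of_exponent_ge h0 h1 (by linarith [Nat.lt_floor_add_one x])

section Transition

open scoped Matrix Matrix.Norms.Operator
open Matrix (rowStochastic)

variable {K : ℕ} {Q : Matrix (Fin K) (Fin K) ℝ} {π : Fin K → ℝ}

theorem exitRate_eq_neg_diag (hQ : IsGenerator Q) (i : Fin K) : exitRate Q i = -Q i i := by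
  have h := hQ.row_sum i
  rw [← Finset.add_sum_erase _ _ (Finset.mem_univ i)] at h
  rw [exitRate]
  linarith

theorem exitRate_pos (hQ : IsGenerator Q) (i : Fin K) : 0 < exitRate Q i := by
  rw [exitRate_eq_neg_diag hQ]
  linarith [hQ.diag_neg i]

theorem hasDerivAt_transition_apply_zero (Q : Matrix (Fin K) (Fin K) ℝ) (i j : Fin K) :
    HasDerivAt (fun t => transition Q t i j) (Q i j) 0 := by
  have h := hasDerivAt_exp_smul_const (𝕂 := ℝ) Q 0
  simp only [zero_smul, NormedSpace.exp_zero, one_mul] at h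
  exact (Matrix.entryLinearMap ℝ ℝ i j).toContinuousLinearMap.hasFDerivAt.comp_hasDerivAt 0 h

theorem transition_zero (Q : Matrix (Fin K) (Fin K) ℝ) : transition Q 0 = 1 := by
  simp only [transition, zero_smul, NormedSpace.exp_zero]

theorem transition_add (Q : Matrix (Fin K) (Fin K) ℝ) (s t : ℝ) :
    transition Q (s + t) = transition Q s * transition Q t := by
  rw [transition, add_smul,
    Matrix.exp_add_of_commute _ _ (((Commute.refl Q).smul_left s).smul_right t)]
  rfl

theorem transition_natCast_mul (Q : Matrix (Fin K) (Fin K) ℝ) (k : ℕ) (t : ℝ) :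
    transition Q (k * t) = transition Q t ^ k := by
  rw [transition, mul_smul, Nat.cast_smul_eq_nsmul, Matrix.exp_nsmul]
  rfl

/- Adding a large multiple of the identity to `t • Q` makes it entrywise nonnegative, and only
multiplies the exponential by a positive constant. -/
theorem exists_mul_one_apply_le_transition_apply (hQ : IsGenerator Q) {t : ℝ} (ht : 0 ≤ t) :
    ∃ r > 0, ∀ i j, r * (1 : Matrix (Fin K) (Fin K) ℝ) i j ≤ transition Q t i j := by
  set c : ℝ := ∑ i, exitRate Q i
  have hnonneg : ∀ i j, 0 ≤ (t • Q + (t * c) • (1 : Matrix (Fin K) (Fin K) ℝ)) i j := by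
    intro i j
    rcases eq_or_ne i j with rfl | hij
    · have hi : exitRate Q i ≤ c := Finset.single_le_sum
        (fun k _ => (exitRate_pos hQ k).le) (Finset.mem_univ i)
      simp only [Matrix.add_apply, Matrix.smul_apply, Matrix.one_apply_eq, smul_eq_mul, mul_one]
      rw [← mul_add]
      exact mul_nonneg ht (by linarith [exitRate_eq_neg_diag hQ i])
    · simpa [Matrix.one_apply_ne hij] using mul_nonneg ht (hQ.offDiag_nonneg i j hij)
  refine ⟨(Real.exp (t * c))⁻¹, by positivity, fun i j => ?_⟩
  have h := one_apply_le_exp_apply hnonneg i j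
  rw [exp_add_smul_one, Matrix.smul_apply, smul_eq_mul] at h
  rwa [inv_mul_le_iff₀ (Real.exp_pos _)]

theorem transition_mem_rowStochastic (hQ : IsGenerator Q) {t : ℝ} (ht : 0 ≤ t) :
    transition Q t ∈ rowStochastic ℝ (Fin K) := by
  refine ⟨fun i j => ?_, exp_mulVec_eq_self ?_⟩
  · obtain ⟨r, hr, hle⟩ := exists_mul_one_apply_le_transition_apply hQ ht
    refine le_trans (mul_nonneg hr.le ?_) (hle i j)
    rw [Matrix.one_apply]
    split_ifs <;> norm_num
  · ext i
    simp [Matrix.mulVec, dotProduct, ← Finset.mul_sum, hQ.row_sum]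

theorem transition_apply_self_pos (hQ : IsGenerator Q) {t : ℝ} (ht : 0 ≤ t) (i : Fin K) :
    0 < transition Q t i i := by
  obtain ⟨r, hr, hle⟩ := exists_mul_one_apply_le_transition_apply hQ ht
  exact lt_of_lt_of_le (by simpa using hr) (hle i i)

theorem IsStationary.sum_mul_transition (hπ : IsStationary Q π) (t : ℝ) (j : Fin K) :
    ∑ i, π i * transition Q t i j = π j := by
  refine congrFun (vecMul_exp_eq_self (v := π) (M := t • Q) ?_) j
  rw [Matrix.vecMul_smul, show π ᵥ* Q = 0 from funext hπ.balance, smul_zero]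

theorem transition_apply_pos_of_le (hQ : IsGenerator Q) {s t : ℝ} (hs : 0 ≤ s) (hst : s ≤ t)
    {i j : Fin K} (h : 0 < transition Q s i j) : 0 < transition Q t i j := by
  have ht : 0 ≤ t - s := sub_nonneg.2 hst
  rw [← add_sub_cancel s t, transition_add, Matrix.mul_apply]
  refine Finset.sum_pos' (fun k _ => ?_)
    ⟨j, Finset.mem_univ j, mul_pos h (transition_apply_self_pos hQ ht j)⟩
  exact mul_nonneg (Matrix.nonneg_of_mem_rowStochastic (transition_mem_rowStochastic hQ hs))
    (Matrix.nonneg_of_mem_rowStochastic (transition_mem_rowStochastic hQ ht))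

theorem IsIrreducible.exists_transition_pos (hQ : IsGenerator Q) (hirr : IsIrreducible Q) :
    ∃ T : ℝ, 0 < T ∧ ∀ i j, 0 < transition Q T i j := by
  choose τ hτ using hirr
  obtain ⟨T, hT⟩ := (Set.finite_range fun p : Fin K × Fin K => τ p.1 p.2).bddAbove
  refine ⟨(T + 1 : ℝ≥0), by positivity, fun i j => ?_⟩
  have hle : τ i j ≤ T + 1 := (hT ⟨(i, j), rfl⟩).trans le_self_add
  exact transition_apply_pos_of_le hQ (τ i j).coe_nonneg (by exact_mod_cast hle) (hτ i j)

theorem exists_lt_transition_apply (hQ : IsGenerator Q) (hirr : IsIrreducible Q) :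
    ∃ T > 0, ∃ ε : ℝ, 0 < ε ∧ ε < 1 ∧ ∀ i j, ε ≤ transition Q T i j := by
  obtain ⟨T, hT, hpos⟩ := hirr.exists_transition_pos hQ
  have hsmall : ∀ᶠ ε : ℝ in 𝓝[>] 0, ∀ p : Fin K × Fin K, ε < transition Q T p.1 p.2 :=
    nhdsWithin_le_nhds (eventually_all.2 fun p => eventually_lt_nhds (hpos p.1 p.2))
  obtain ⟨ε, hε, hε0, hε1⟩ := (hsmall.and (Ioo_mem_nhdsGT zero_lt_one)).exists
  exact ⟨T, hT, ε, hε0, hε1, fun i j => (hε (i, j)).le⟩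

theorem exists_abs_transition_sub_le (hQ : IsGenerator Q) (hirr : IsIrreducible Q)
    (hπ : IsStationary Q π) :
    ∃ C c : ℝ, 1 ≤ C ∧ 0 < c ∧ ∀ t : ℝ, 0 ≤ t → ∀ a i,
      |transition Q t a i - π i| ≤ C * Real.exp (-(c * t)) := by
  obtain ⟨T, hT, ε, hε0, hε1, hε⟩ := exists_lt_transition_apply hQ hirr
  have hr : 0 < 1 - ε := by linarith
  have hosc : ∀ t, 0 ≤ t → ∀ i a b,
      transition Q t a i - transition Q t b i ≤ (1 - ε) ^ ⌊t / T⌋₊ := by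
    intro t ht i a b
    have hrem : 0 ≤ t - ⌊t / T⌋₊ * T :=
      sub_nonneg.2 ((le_div_iff₀ hT).1 (Nat.floor_le (by positivity)))
    have h := pow_mul_apply_sub_le (transition_mem_rowStochastic hQ hT.le)
      (transition_mem_rowStochastic hQ hrem) hε ⌊t / T⌋₊ a b i
    rwa [← transition_natCast_mul, ← transition_add, add_sub_cancel] at h
  refine ⟨(1 - ε)⁻¹, -Real.log (1 - ε) / T, (one_le_inv₀ hr).2 (by linarith),
    div_pos (neg_pos.2 (Real.log_neg hr (by linarith))) hT, fun t ht a i => ?_⟩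
  rw [← hπ.sum_mul_transition t i]
  calc |transition Q t a i - ∑ j, π j * transition Q t j i| ≤ (1 - ε) ^ ⌊t / T⌋₊ :=
        abs_sub_sum_mul_le hπ.nonneg hπ.sum_eq_one (hosc t ht i) a
    _ ≤ (1 - ε)⁻¹ * Real.exp (Real.log (1 - ε) * (t / T)) :=
        pow_floor_le_exp hr (by linarith) (t / T)
    _ = (1 - ε)⁻¹ * Real.exp (-(-Real.log (1 - ε) / T * t)) := by ring_nf

end Transition

section DiscreteFresh

variable {S : Type*} {y : ℕ → S} {β : ℕ → Prop}

/-- Freshness at step `k` in discrete time, for a source `y` that is observed at the end of the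
steps `l` with `β l`, that is, at the times `l + 1`. -/
def DiscreteFresh (y : ℕ → S) (β : ℕ → Prop) (k : ℕ) : Prop :=
  ∃ l < k, β l ∧ ∀ j, l < j → j ≤ k → y j = y k

theorem not_discreteFresh_zero : ¬DiscreteFresh y β 0 := fun ⟨_, hl, _⟩ => Nat.not_lt_zero _ hl

theorem discreteFresh_succ_iff {k : ℕ} :
    DiscreteFresh y β (k + 1) ↔ β k ∨ (DiscreteFresh y β k ∧ y (k + 1) = y k) := by
  constructor
  · rintro ⟨l, hl, hβ, hconst⟩
    rcases (Nat.lt_succ_iff.1 hl).eq_or_lt with rfl | hlk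
    · exact Or.inl hβ
    · have hlast : y k = y (k + 1) := hconst k hlk (Nat.le_succ k)
      exact Or.inr ⟨⟨l, hlk, hβ, fun j hlj hjk => (hconst j hlj (by omega)).trans hlast.symm⟩,
        hlast.symm⟩
  · rintro (hβ | ⟨⟨l, hlk, hβ, hconst⟩, hlast⟩)
    · exact ⟨k, Nat.lt_succ_self k, hβ, fun j hkj hjk => by rw [show j = k + 1 by omega]⟩
    · refine ⟨l, by omega, hβ, fun j hlj hjk => ?_⟩
      rcases hjk.eq_or_lt with rfl | hjk
      · rfl
      · exact (hconst j hlj (by omega)).trans hlast.symm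

end DiscreteFresh

section SampledChain

variable {S Ω : Type*} [MeasurableSpace S] {mΩ : MeasurableSpace Ω}

/-- The event that a random source `Y`, observed at the end of the steps `l` at which the event
`B l` occurs, is fresh at step `k`. -/
def freshSet (Y : ℕ → Ω → S) (B : ℕ → Set Ω) (k : ℕ) : Set Ω :=
  {ω | DiscreteFresh (fun j => Y j ω) (fun j => ω ∈ B j) k}

/-- `Y` is a Markov chain with transition matrix `P` relative to the filtration `ℱ`, and the `k`-th
step is observed if the event `B k` occurs. The chain is not observed with probability `q`,
independently of the past and of the step that it makes. -/
structure IsSampledChain [Fintype S] (P : Matrix S S ℝ) (q : ℝ) (ℱ : Filtration ℕ mΩ)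
    (Y : ℕ → Ω → S) (B : ℕ → Set Ω) (μ : Measure Ω) : Prop where
  adapted : ∀ k, Measurable[ℱ k] (Y k)
  measurableSet_obs : ∀ k, MeasurableSet[ℱ (k + 1)] (B k)
  step : ∀ k E, MeasurableSet[ℱ k] E → ∀ a i,
    μ.real (E ∩ Y k ⁻¹' {a} ∩ Y (k + 1) ⁻¹' {i}) = μ.real (E ∩ Y k ⁻¹' {a}) * P a i
  step_diff : ∀ k E, MeasurableSet[ℱ k] E → ∀ a i,
    μ.real ((E ∩ Y k ⁻¹' {a} ∩ Y (k + 1) ⁻¹' {i}) \ B k) = μ.real (E ∩ Y k ⁻¹' {a}) * P a i * q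

/-- The stationary probability of freshness for a chain with transition matrix `P` and stationary
distribution `π` each of whose steps is observed with probability `1 - q`. -/
noncomputable def sampledMean [Fintype S] (P : Matrix S S ℝ) (π : S → ℝ) (q : ℝ) : ℝ :=
  ∑ i, (1 - q) * π i / (1 - q * P i i)

section Sum

variable [Fintype S] [MeasurableSingletonClass S] {μ : Measure Ω} [IsFiniteMeasure μ]

theorem measureReal_eq_sum_inter_preimage {f : Ω → S} (hf : Measurable f) (E : Set Ω) :
    μ.real E = ∑ a, μ.real (E ∩ f ⁻¹' {a}) := by
  have h := sum_measureReal_preimage_singleton (μ := μ.restrict E) Finset.univ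
    (fun a _ => hf (measurableSet_singleton a))
  rw [Finset.coe_univ, preimage_univ, measureReal_restrict_apply MeasurableSet.univ,
    univ_inter] at h
  rw [← h]
  refine Finset.sum_congr rfl fun a _ => ?_
  rw [measureReal_restrict_apply (hf (measurableSet_singleton a)), inter_comm]

end Sum

namespace IsSampledChain

variable [Fintype S] {P : Matrix S S ℝ} {q : ℝ}
  {ℱ : Filtration ℕ mΩ} {Y : ℕ → Ω → S} {B : ℕ → Set Ω} {μ : Measure Ω}

theorem measurable (h : IsSampledChain P q ℱ Y B μ) (k : ℕ) : Measurable (Y k) :=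
  (h.adapted k).mono (ℱ.le k) le_rfl

variable [MeasurableSingletonClass S]

theorem measurableSet_freshSet (h : IsSampledChain P q ℱ Y B μ) (k : ℕ) :
    MeasurableSet[ℱ k] (freshSet Y B k) := by
  induction k with
  | zero => simp only [freshSet, not_discreteFresh_zero, ofPred_false, MeasurableSet.empty]
  | succ k ih =>
    have hmono := ℱ.mono (Nat.le_succ k)
    have hstay : MeasurableSet[ℱ (k + 1)] {ω | Y (k + 1) ω = Y k ω} :=
      measurableSet_eq_fun (h.adapted (k + 1)) ((h.adapted k).mono hmono le_rfl)
    convert (h.measurableSet_obs k).union ((hmono _ ih).inter hstay) using 1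
    ext ω
    exact discreteFresh_succ_iff

variable [IsFiniteMeasure μ]

theorem measureReal_succ (h : IsSampledChain P q ℱ Y B μ) {k : ℕ} {E : Set Ω}
    (hE : MeasurableSet[ℱ k] E) (i : S) :
    μ.real (E ∩ Y (k + 1) ⁻¹' {i}) = ∑ a, μ.real (E ∩ Y k ⁻¹' {a}) * P a i := by
  rw [measureReal_eq_sum_inter_preimage (h.measurable k)]
  exact Finset.sum_congr rfl fun a _ => by rw [inter_right_comm, h.step k E hE]

theorem measureReal_succ_diff (h : IsSampledChain P q ℱ Y B μ) {k : ℕ} {E : Set Ω}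
    (hE : MeasurableSet[ℱ k] E) (i : S) :
    μ.real ((E ∩ Y (k + 1) ⁻¹' {i}) \ B k) = μ.real (E ∩ Y (k + 1) ⁻¹' {i}) * q := by
  rw [h.measureReal_succ hE, measureReal_eq_sum_inter_preimage (h.measurable k), Finset.sum_mul]
  refine Finset.sum_congr rfl fun a _ => ?_
  rw [sdiff_inter_right_comm, inter_right_comm, h.step_diff k E hE]

theorem measureReal_add [DecidableEq S] (h : IsSampledChain P q ℱ Y B μ) {j : ℕ} {E : Set Ω}
    (hE : MeasurableSet[ℱ j] E) (l : ℕ) (i : S) :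
    μ.real (E ∩ Y (j + l) ⁻¹' {i}) = ∑ a, μ.real (E ∩ Y j ⁻¹' {a}) * (P ^ l) a i := by
  induction l generalizing i with
  | zero => simp [Matrix.one_apply]
  | succ l ih =>
    rw [← add_assoc, h.measureReal_succ (ℱ.mono (Nat.le_add_right j l) _ hE)]
    simp only [ih, pow_succ, Matrix.mul_apply, Finset.sum_mul, Finset.mul_sum, mul_assoc]
    exact Finset.sum_comm

theorem measureReal_freshSet_succ (h : IsSampledChain P q ℱ Y B μ) {k : ℕ} {E : Set Ω}
    (hE : MeasurableSet[ℱ k] E) (i : S) :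
    μ.real (E ∩ freshSet Y B (k + 1) ∩ Y (k + 1) ⁻¹' {i}) =
      (1 - q) * μ.real (E ∩ Y (k + 1) ⁻¹' {i}) +
        q * P i i * μ.real (E ∩ freshSet Y B k ∩ Y k ⁻¹' {i}) := by
  have hB : MeasurableSet (B k) := ℱ.le (k + 1) _ (h.measurableSet_obs k)
  have hobs : E ∩ freshSet Y B (k + 1) ∩ Y (k + 1) ⁻¹' {i} ∩ B k =
      E ∩ Y (k + 1) ⁻¹' {i} ∩ B k := by
    ext ω
    simp only [freshSet, mem_inter_iff, mem_ofPred_eq, discreteFresh_succ_iff]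
    tauto
  have hunobs : (E ∩ freshSet Y B (k + 1) ∩ Y (k + 1) ⁻¹' {i}) \ B k =
      (E ∩ freshSet Y B k ∩ Y k ⁻¹' {i} ∩ Y (k + 1) ⁻¹' {i}) \ B k := by
    ext ω
    simp only [freshSet, mem_inter_iff, Set.mem_sdiff, mem_ofPred_eq, discreteFresh_succ_iff,
      mem_preimage, mem_singleton_iff]
    grind
  have hsplit := measureReal_inter_add_sdiff (μ := μ) (s := E ∩ Y (k + 1) ⁻¹' {i}) hB
  rw [h.measureReal_succ_diff hE] at hsplit
  rw [← measureReal_inter_add_sdiff (s := E ∩ freshSet Y B (k + 1) ∩ Y (k + 1) ⁻¹' {i}) hB,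
    hobs, hunobs, h.step_diff k _ (hE.inter (h.measurableSet_freshSet k))]
  linarith

end IsSampledChain

end SampledChain

section Mixing

theorem le_two_mul_pow_of_recursion {e : ℕ → ℝ} {C q ρ : ℝ} (hC : 0 ≤ C) (hq : 0 ≤ q)
    (hqρ : q ≤ ρ ^ 2) (hρ0 : 0 ≤ ρ) (hρ1 : ρ ≤ 1) (h0 : e 0 ≤ 2 * C)
    (hrec : ∀ l, e (l + 1) ≤ (1 - q) * (C * ρ ^ (l + 1)) + q * e l) (l : ℕ) :
    e l ≤ 2 * C * ρ ^ l := by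
  have hkey : (1 - q) * ρ + 2 * q ≤ 2 * ρ := by
    have hid : 2 * ρ - ((1 - q) * ρ + 2 * q) = ρ * (1 - ρ) ^ 2 + (ρ ^ 2 - q) * (2 - ρ) := by ring
    have h1 : 0 ≤ ρ * (1 - ρ) ^ 2 := by positivity
    have h2 : 0 ≤ (ρ ^ 2 - q) * (2 - ρ) := mul_nonneg (by linarith) (by linarith)
    exact sub_nonneg.1 (hid ▸ add_nonneg h1 h2)
  induction l with
  | zero => simpa using h0
  | succ l ih =>
    calc e (l + 1) ≤ (1 - q) * (C * ρ ^ (l + 1)) + q * (2 * C * ρ ^ l) :=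
          (hrec l).trans (by gcongr)
      _ = C * ρ ^ l * ((1 - q) * ρ + 2 * q) := by ring
      _ ≤ C * ρ ^ l * (2 * ρ) := by gcongr
      _ = 2 * C * ρ ^ (l + 1) := by ring

namespace IsSampledChain

open Matrix (rowStochastic)

variable {S Ω : Type*} [MeasurableSpace S] [MeasurableSingletonClass S] [Fintype S] [DecidableEq S]
  {mΩ : MeasurableSpace Ω} {μ : Measure Ω} [IsProbabilityMeasure μ] {P : Matrix S S ℝ} {q : ℝ}
  {ℱ : Filtration ℕ mΩ} {Y : ℕ → Ω → S} {B : ℕ → Set Ω} {π : S → ℝ} {C ρ : ℝ}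

theorem abs_measureReal_add_sub_le (h : IsSampledChain P q ℱ Y B μ) {j : ℕ} {E : Set Ω}
    (hE : MeasurableSet[ℱ j] E) {l : ℕ} {i : S} {d : ℝ} (hd : ∀ a, |(P ^ l) a i - π i| ≤ d) :
    |μ.real (E ∩ Y (j + l) ⁻¹' {i}) - π i * μ.real E| ≤ d := by
  have hd0 : 0 ≤ d := (abs_nonneg _).trans (hd i)
  have hsum : ∑ a, μ.real (E ∩ Y j ⁻¹' {a}) = μ.real E :=
    (measureReal_eq_sum_inter_preimage (h.measurable j) E).symm
  have hdiff : μ.real (E ∩ Y (j + l) ⁻¹' {i}) - π i * μ.real E =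
      ∑ a, μ.real (E ∩ Y j ⁻¹' {a}) * ((P ^ l) a i - π i) := by
    simp only [h.measureReal_add hE, mul_sub, Finset.sum_sub_distrib, ← Finset.sum_mul, hsum]
    ring
  calc |μ.real (E ∩ Y (j + l) ⁻¹' {i}) - π i * μ.real E|
      ≤ ∑ a, |μ.real (E ∩ Y j ⁻¹' {a}) * ((P ^ l) a i - π i)| :=
        hdiff ▸ Finset.abs_sum_le_sum_abs _ _
    _ ≤ ∑ a, μ.real (E ∩ Y j ⁻¹' {a}) * d := by
        refine Finset.sum_le_sum fun a _ => ?_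
        rw [abs_mul, abs_of_nonneg measureReal_nonneg]
        exact mul_le_mul_of_nonneg_left (hd a) measureReal_nonneg
    _ = μ.real E * d := by rw [← Finset.sum_mul, hsum]
    _ ≤ d := mul_le_of_le_one_left hd0 measureReal_le_one

theorem abs_measureReal_freshSet_succ_inter_sub_le (h : IsSampledChain P q ℱ Y B μ)
    (hP : P ∈ rowStochastic ℝ S) (hq0 : 0 ≤ q) (hq1 : q ≤ 1) {k : ℕ} {E : Set Ω}
    (hE : MeasurableSet[ℱ k] E) {i : S} {v : ℝ} (hv : v = (1 - q) * π i + q * P i i * v) :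
    |μ.real (E ∩ freshSet Y B (k + 1) ∩ Y (k + 1) ⁻¹' {i}) - v * μ.real E| ≤
      (1 - q) * |μ.real (E ∩ Y (k + 1) ⁻¹' {i}) - π i * μ.real E| +
        q * |μ.real (E ∩ freshSet Y B k ∩ Y k ⁻¹' {i}) - v * μ.real E| := by
  set u : ℝ := μ.real (E ∩ freshSet Y B k ∩ Y k ⁻¹' {i})
  set w : ℝ := μ.real (E ∩ Y (k + 1) ⁻¹' {i})
  have hPi0 : 0 ≤ P i i := Matrix.nonneg_of_mem_rowStochastic hP
  have hPi1 : P i i ≤ 1 := Matrix.le_one_of_mem_rowStochastic hP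
  calc |μ.real (E ∩ freshSet Y B (k + 1) ∩ Y (k + 1) ⁻¹' {i}) - v * μ.real E|
      = |(1 - q) * (w - π i * μ.real E) + q * P i i * (u - v * μ.real E)| := by
        rw [h.measureReal_freshSet_succ hE]
        congr 1
        linear_combination -μ.real E * hv
    _ ≤ (1 - q) * |w - π i * μ.real E| + q * P i i * |u - v * μ.real E| := by
        refine (abs_add_le _ _).trans_eq ?_
        rw [abs_mul, abs_mul, abs_of_nonneg (sub_nonneg.2 hq1),
          abs_of_nonneg (mul_nonneg hq0 hPi0)]
    _ ≤ (1 - q) * |w - π i * μ.real E| + q * |u - v * μ.real E| := by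
        gcongr
        exact mul_le_of_le_one_right hq0 hPi1

theorem abs_measureReal_freshSet_inter_sub_le (h : IsSampledChain P q ℱ Y B μ)
    (hP : P ∈ rowStochastic ℝ S) (hq0 : 0 ≤ q) (hq1 : q < 1) (hqρ : q ≤ ρ ^ 2) (hρ0 : 0 ≤ ρ)
    (hρ1 : ρ ≤ 1) (hC : 1 ≤ C) (hmix : ∀ l a i, |(P ^ l) a i - π i| ≤ C * ρ ^ l) {j : ℕ}
    {E : Set Ω} (hE : MeasurableSet[ℱ j] E) (i : S) (hπ0 : 0 ≤ π i) (hπ1 : π i ≤ 1) (l : ℕ) :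
    |μ.real (E ∩ freshSet Y B (j + l) ∩ Y (j + l) ⁻¹' {i}) -
      (1 - q) * π i / (1 - q * P i i) * μ.real E| ≤ 2 * C * ρ ^ l := by
  set v : ℝ := (1 - q) * π i / (1 - q * P i i) with hv
  have hqP : q * P i i ≤ q := mul_le_of_le_one_right hq0 (Matrix.le_one_of_mem_rowStochastic hP)
  have hden : 0 < 1 - q * P i i := by linarith
  have hfix : v = (1 - q) * π i + q * P i i * v := by
    rw [hv]
    field_simp
    ring
  have hv0 : 0 ≤ v := div_nonneg (mul_nonneg (by linarith) hπ0) hden.le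
  have hv1 : v ≤ 1 := (div_le_one hden).2 (by nlinarith)
  refine le_two_mul_pow_of_recursion (e := fun l =>
    |μ.real (E ∩ freshSet Y B (j + l) ∩ Y (j + l) ⁻¹' {i}) - v * μ.real E|)
    (by linarith) hq0 hqρ hρ0 hρ1 ?_ (fun l => ?_) l
  · have hinit := Real.dist_le_of_mem_Icc_01
      (x := μ.real (E ∩ freshSet Y B (j + 0) ∩ Y (j + 0) ⁻¹' {i})) (y := v * μ.real E)
      ⟨measureReal_nonneg, measureReal_le_one⟩
      ⟨mul_nonneg hv0 measureReal_nonneg, mul_le_one₀ hv1 measureReal_nonneg measureReal_le_one⟩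
    rw [Real.dist_eq] at hinit
    linarith
  · refine (h.abs_measureReal_freshSet_succ_inter_sub_le hP hq0 hq1.le
      (ℱ.mono (Nat.le_add_right j l) _ hE) hfix).trans ?_
    have hw := h.abs_measureReal_add_sub_le hE fun a => hmix (l + 1) a i
    rw [add_assoc]
    gcongr

theorem abs_measureReal_freshSet_sub_le (h : IsSampledChain P q ℱ Y B μ)
    (hP : P ∈ rowStochastic ℝ S) (hq0 : 0 ≤ q) (hq1 : q < 1) (hqρ : q ≤ ρ ^ 2) (hρ0 : 0 ≤ ρ)
    (hρ1 : ρ ≤ 1) (hC : 1 ≤ C) (hmix : ∀ l a i, |(P ^ l) a i - π i| ≤ C * ρ ^ l)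
    (hπ0 : ∀ i, 0 ≤ π i) (hπ1 : ∑ i, π i = 1) {j : ℕ} {E : Set Ω}
    (hE : MeasurableSet[ℱ j] E) (l : ℕ) :
    |μ.real (E ∩ freshSet Y B (j + l)) - sampledMean P π q * μ.real E| ≤
      Fintype.card S * (2 * C * ρ ^ l) := by
  rw [measureReal_eq_sum_inter_preimage (h.measurable (j + l)), sampledMean, Finset.sum_mul,
    ← Finset.sum_sub_distrib, ← nsmul_eq_mul, ← Finset.card_univ, ← Finset.sum_const]
  refine (Finset.abs_sum_le_sum_abs _ _).trans (Finset.sum_le_sum fun i _ => ?_)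
  exact h.abs_measureReal_freshSet_inter_sub_le hP hq0 hq1 hqρ hρ0 hρ1 hC hmix hE i (hπ0 i)
    (hπ1 ▸ Finset.single_le_sum (fun k _ => hπ0 k) (Finset.mem_univ i)) l

end IsSampledChain

end Mixing

section Paths

section Discrete

variable {S : Type*} [TopologicalSpace S] {x : ℝ≥0 → S}

theorem JumpsAt.pos {s : ℝ≥0} (h : JumpsAt x s) (hx : ContinuousWithinAt x (Ici 0) 0) :
    0 < s := by
  refine pos_iff_ne_zero.2 fun h0 => h ?_
  rwa [h0, ← continuousWithinAt_univ, ← Ici_bot, NNReal.bot_eq_zero]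

theorem not_jumpsAt_of_forall_mem_Icc_eq {s u : ℝ≥0} (hx : ContinuousWithinAt x (Ici u) u)
    (hsu : s < u) (h : ∀ v ∈ Icc s u, x v = x u) : ¬JumpsAt x u := by
  rw [JumpsAt, not_not, continuousAt_iff_continuous_left_right]
  refine ⟨continuousWithinAt_const.congr_of_eventuallyEq ?_ rfl, hx⟩
  filter_upwards [Icc_mem_nhdsLE hsu] using h

variable [DiscreteTopology S]

theorem eventually_forall_mem_Icc_eq {t : ℝ≥0} (h : ContinuousWithinAt x (Ici t) t) :
    ∀ᶠ u in 𝓝[≥] t, ∀ v ∈ Icc t u, x v = x t := by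
  obtain ⟨w, hw, hsub⟩ := (mem_nhdsGE_iff_exists_Ico_subset' (lt_add_one t)).1
    (h ((isOpen_discrete {x t}).mem_nhds rfl))
  filter_upwards [Ico_mem_nhdsGE hw] with u hu v hv
  exact hsub ⟨hv.1, hv.2.trans_lt hu.2⟩

theorem eq_of_forall_not_jumpsAt (hx : ∀ t, ContinuousWithinAt x (Ici t) t) {s t : ℝ≥0}
    (h : ∀ u ∈ Ioc s t, ¬JumpsAt x u) {u : ℝ≥0} (hu : u ∈ Icc s t) : x u = x t := by
  have hc : ContinuousOn x (Icc s t) := by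
    intro v hv
    rcases hv.1.eq_or_lt with rfl | hlt
    · exact (hx s).mono Icc_subset_Ici_self
    · exact (not_not.1 (h v ⟨hlt, hv.2⟩)).continuousWithinAt
  exact isPreconnected_Icc.constant hc hu ⟨hu.1.trans hu.2, le_rfl⟩

theorem forall_not_jumpsAt_iff (hx : ∀ t, ContinuousWithinAt x (Ici t) t) {s t : ℝ≥0} :
    (∀ u ∈ Ioc s t, ¬JumpsAt x u) ↔ ∀ u ∈ Icc s t, x u = x t := by
  refine ⟨fun h u hu => eq_of_forall_not_jumpsAt hx h hu, fun h u hu => ?_⟩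
  refine not_jumpsAt_of_forall_mem_Icc_eq (hx u) hu.1 fun v hv => ?_
  rw [h v ⟨hv.1, hv.2.trans hu.2⟩, h u ⟨hu.1.le, hu.2⟩]

end Discrete

/-- `s` is the time of the last sample up to time `t`, for a path `n` counting the samples. (If
there is no such sample then `s = 0`.) -/
structure IsLastSample (n : ℝ≥0 → ℕ) (s t : ℝ≥0) : Prop where
  le : s ≤ t
  eq : n s = n t
  lt : ∀ r < s, n r < n t

variable {K : ℕ} {x : ℝ≥0 → Fin K} {n : ℝ≥0 → ℕ} {s t : ℝ≥0}

theorem exists_isLastSample (hn : Monotone n) (hnr : ∀ t, ContinuousWithinAt n (Ici t) t)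
    (t : ℝ≥0) : ∃ s, IsLastSample n s t := by
  set A : Set ℝ≥0 := {r | n t ≤ n r}
  have htA : t ∈ A := le_refl (n t)
  have hst : sInf A ≤ t := csInf_le' htA
  have hfreq : ∃ᶠ r in 𝓝[≥] sInf A, r ∈ A :=
    (isGLB_csInf ⟨t, htA⟩ (OrderBot.bddBelow A)).frequently_mem ⟨t, htA⟩
  obtain ⟨r, hrA, hr⟩ := (hfreq.and_eventually
    ((eventually_forall_mem_Icc_eq (hnr _)).and self_mem_nhdsWithin)).exists
  have hge : n t ≤ n (sInf A) := (hr.1 r ⟨hr.2, le_rfl⟩) ▸ hrA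
  exact ⟨sInf A, hst, (hn hst).antisymm hge,
    fun r hr => not_le.1 fun h => notMem_of_lt_csInf' hr h⟩

theorem IsLastSample.jumpsAt (h : IsLastSample n s t) (hs : 0 < s) : JumpsAt n s := by
  intro hc
  have hev : ∀ᶠ v in 𝓝[<] s, n v = n s :=
    (hc.mono_left nhdsWithin_le_nhds) ((isOpen_discrete {n s}).mem_nhds rfl)
  have : (𝓝[<] s).NeBot := nhdsLT_neBot_of_exists_lt ⟨0, hs⟩
  obtain ⟨v, hv, hvs⟩ := (hev.and self_mem_nhdsWithin).exists
  exact (h.lt v hvs).ne (hv.trans h.eq)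

theorem IsLastSample.le_of_jumpsAt (h : IsLastSample n s t) (hn : Monotone n)
    (hnr : ∀ t, ContinuousWithinAt n (Ici t) t) {r : ℝ≥0} (hrt : r ≤ t) (hr : JumpsAt n r) :
    r ≤ s := by
  by_contra! hsr
  have hconst : ∀ v ∈ Icc s t, n v = n t := fun v hv =>
    (hn hv.2).antisymm (h.eq ▸ hn hv.1)
  refine not_jumpsAt_of_forall_mem_Icc_eq (hnr r) hsr (fun v hv => ?_) hr
  rw [hconst v ⟨hv.1, hv.2.trans hrt⟩, hconst r ⟨hsr.le, hrt⟩]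

theorem IsLastSample.isFresh_iff (h : IsLastSample n s t)
    (hx : ∀ t, ContinuousWithinAt x (Ici t) t) (hn : Monotone n)
    (hnr : ∀ t, ContinuousWithinAt n (Ici t) t) :
    IsFresh x n false t ↔ 0 < s ∧ ∀ u ∈ Icc s t, x u = x t := by
  simp only [IsFresh, Bool.false_eq_true, false_and, or_false, forall_not_jumpsAt_iff hx]
  constructor
  · rintro ⟨r, hrt, hr, hconst⟩
    have hrs : r ≤ s := h.le_of_jumpsAt hn hnr hrt hr
    exact ⟨(hr.pos (hnr 0)).trans_le hrs, fun u hu => hconst u ⟨hrs.trans hu.1, hu.2⟩⟩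
  · rintro ⟨hs, hconst⟩
    exact ⟨s, h.le, h.jumpsAt hs, hconst⟩

end Paths

section Grid

/-- The `k`-th point of the grid of mesh `1 / m`. -/
noncomputable def gridTime (m k : ℕ) : ℝ≥0 := k / m

theorem gridTime_mono (m : ℕ) : Monotone (gridTime m) := fun _ _ h => by
  unfold gridTime
  gcongr

theorem le_gridTime_iff {m : ℕ} (hm : 0 < m) {t : ℝ≥0} {k : ℕ} :
    t ≤ gridTime m k ↔ ⌈t * m⌉₊ ≤ k := by
  rw [gridTime, le_div_iff₀ (by exact_mod_cast hm), Nat.ceil_le]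

theorem tendsto_gridTime_natCeil (t : ℝ≥0) :
    Tendsto (fun m : ℕ => gridTime m ⌈t * m⌉₊) atTop (𝓝[≥] t) := by
  refine tendsto_nhdsWithin_iff.2 ⟨?_, ?_⟩
  · have hlim : Tendsto (fun m : ℕ => t + 1 / (m : ℝ≥0)) atTop (𝓝 (t + 0)) :=
      tendsto_const_nhds.add tendsto_one_div_atTop_nhds_zero_nat
    rw [add_zero] at hlim
    refine tendsto_of_tendsto_of_tendsto_of_le_of_le' tendsto_const_nhds hlim ?_ ?_
    · filter_upwards [eventually_gt_atTop 0] with m hm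
      exact (le_gridTime_iff hm).2 le_rfl
    · filter_upwards [eventually_gt_atTop 0] with m hm
      have hm' : (0 : ℝ≥0) < m := by exact_mod_cast hm
      rw [gridTime, div_le_iff₀ hm', add_mul, one_div_mul_cancel hm'.ne']
      exact (Nat.ceil_lt_add_one zero_le).le
  · filter_upwards [eventually_gt_atTop 0] with m hm
    exact (le_gridTime_iff hm).2 le_rfl

/-- Freshness at the `k`-th point of the grid of mesh `1 / m`, for a source and a counting path that
are only known at the grid points. -/
def GridFresh {S : Type*} (x : ℝ≥0 → S) (n : ℝ≥0 → ℕ) (m k : ℕ) : Prop :=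
  DiscreteFresh (fun j => x (gridTime m j)) (fun j => n (gridTime m j) < n (gridTime m (j + 1))) k

theorem IsLastSample.gridFresh_iff {S : Type*} {x : ℝ≥0 → S} {n : ℝ≥0 → ℕ} {s : ℝ≥0} {m k : ℕ}
    (h : IsLastSample n s (gridTime m k)) (hn : Monotone n) (hm : 0 < m) :
    GridFresh x n m k ↔
      0 < s ∧ ∀ j ≤ k, s ≤ gridTime m j → x (gridTime m j) = x (gridTime m k) := by
  have hlt : ∀ r, n r < n (gridTime m k) ↔ r < s := fun r =>
    ⟨fun hr => hn.reflect_lt (hr.trans_eq h.eq.symm), h.lt r⟩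
  constructor
  · rintro ⟨l, hlk, hobs, hconst⟩
    have hls : gridTime m l < s := (hlt _).1 (hobs.trans_le (hn (gridTime_mono m hlk)))
    exact ⟨pos_of_gt hls,
      fun j hjk hsj => hconst j ((gridTime_mono m).reflect_lt (hls.trans_le hsj)) hjk⟩
  · rintro ⟨hs, hconst⟩
    have hceil : ∀ j, s ≤ gridTime m j ↔ ⌈s * m⌉₊ ≤ j := fun _ => le_gridTime_iff hm
    obtain ⟨l, hl⟩ : ∃ l, ⌈s * m⌉₊ = l + 1 := Nat.exists_eq_add_one.2
      (Nat.ceil_pos.2 (mul_pos hs (by exact_mod_cast hm)))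
    rw [hl] at hceil
    have hls : gridTime m l < s := not_le.1 fun hsl => by simpa using (hceil l).1 hsl
    refine ⟨l, (hceil k).1 h.le, ?_, fun j hlj hjk => hconst j hjk ((hceil j).2 hlj)⟩
    exact (h.lt _ hls).trans_le (h.eq ▸ hn ((hceil _).2 le_rfl))

theorem eventually_forall_mem_Icc_gridTime_eq {S : Type*} [TopologicalSpace S]
    [DiscreteTopology S] {x : ℝ≥0 → S} {t : ℝ≥0} (hx : ContinuousWithinAt x (Ici t) t) :
    ∀ᶠ m : ℕ in atTop, ∀ u ∈ Icc t (gridTime m ⌈t * m⌉₊), x u = x t :=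
  (tendsto_gridTime_natCeil t).eventually (eventually_forall_mem_Icc_eq hx)

theorem eventually_gridFresh_iff {K : ℕ} {x : ℝ≥0 → Fin K} {n : ℝ≥0 → ℕ}
    (hx : ∀ t, ContinuousWithinAt x (Ici t) t) (hn : Monotone n)
    (hnr : ∀ t, ContinuousWithinAt n (Ici t) t) (t : ℝ≥0) :
    ∀ᶠ m : ℕ in atTop, (GridFresh x n m ⌈t * m⌉₊ ↔ IsFresh x n false t) := by
  obtain ⟨s, hs⟩ := exists_isLastSample hn hnr t
  have hmove : ∀ᶠ m : ℕ in atTop, (∃ u ∈ Icc s t, x u ≠ x t) →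
      ∃ j ≤ ⌈t * m⌉₊, s ≤ gridTime m j ∧ x (gridTime m j) ≠ x t := by
    by_cases hex : ∃ u ∈ Icc s t, x u ≠ x t
    · obtain ⟨u, hu, hne⟩ := hex
      filter_upwards [eventually_forall_mem_Icc_gridTime_eq (hx u), eventually_gt_atTop 0]
        with m hxu hm _
      have hle : u ≤ gridTime m ⌈u * m⌉₊ := (le_gridTime_iff hm).2 le_rfl
      exact ⟨⌈u * m⌉₊, by gcongr; exact hu.2, hu.1.trans hle, by rwa [hxu _ ⟨hle, le_rfl⟩]⟩
    · exact Eventually.of_forall fun m h => absurd h hex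
  filter_upwards [eventually_forall_mem_Icc_gridTime_eq (hx t),
    eventually_forall_mem_Icc_gridTime_eq (hnr t), eventually_gt_atTop 0, hmove]
    with m hxt hnt hm hmove
  have hle : t ≤ gridTime m ⌈t * m⌉₊ := (le_gridTime_iff hm).2 le_rfl
  have hgrid : IsLastSample n s (gridTime m ⌈t * m⌉₊) :=
    ⟨hs.le.trans hle, by rw [hnt _ ⟨hle, le_rfl⟩, hs.eq],
      fun r hr => (hs.lt r hr).trans_le (hn hle)⟩
  rw [hgrid.gridFresh_iff hn hm, hs.isFresh_iff hx hn hnr, hxt _ ⟨hle, le_rfl⟩]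
  refine and_congr_right fun _ => ⟨fun h => ?_, fun h j hj hsj => ?_⟩
  · by_contra! hex
    obtain ⟨j, hj, hsj, hne⟩ := hmove hex
    exact hne (h j hj hsj)
  · rcases le_total (gridTime m j) t with hjt | hjt
    · exact h _ ⟨hsj, hjt⟩
    · exact hxt _ ⟨hjt, gridTime_mono m hj⟩

end Grid

section Independence

variable {Ω : Type*} {mΩ : MeasurableSpace Ω} {μ : Measure Ω}

theorem measurable_natural {S : Type*} [TopologicalSpace S] [TopologicalSpace.MetrizableSpace S]
    [MeasurableSpace S] [BorelSpace S] {Z : ℕ → Ω → S} (hZ : ∀ k, StronglyMeasurable (Z k))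
    {j k : ℕ} (hjk : j ≤ k) : Measurable[Filtration.natural Z hZ k] (Z j) :=
  (comap_measurable (Z j)).mono (le_iSup₂_of_le j hjk le_rfl) le_rfl

theorem indep_natural_increment {Z : ℕ → Ω → ℕ} (hZ : ∀ k, Measurable (Z k)) (h0 : ∀ ω, Z 0 ω = 0)
    (hmono : ∀ ω, Monotone fun k => Z k ω)
    (hindep : iIndepFun (fun k ω => Z (k + 1) ω - Z k ω) μ) (k : ℕ) :
    Indep (Filtration.natural Z (fun k => (hZ k).stronglyMeasurable) k)
      (MeasurableSpace.comap (fun ω => Z (k + 1) ω - Z k ω) ⊤) μ := by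
  have hle : ∀ j, MeasurableSpace.comap (fun ω => Z (j + 1) ω - Z j ω) ⊤ ≤ mΩ := fun j =>
    ((hZ (j + 1)).sub (hZ j)).comap_le
  have h := indep_iSup_of_disjoint hle hindep (S := Iio k) (T := {k})
    (disjoint_singleton_right.2 (lt_irrefl k))
  rw [iSup_singleton] at h
  refine indep_of_indep_of_le_left h (iSup₂_le fun j hj => ?_)
  have hsum : Z j = fun ω => ∑ i ∈ Finset.range j, (Z (i + 1) ω - Z i ω) := funext fun ω => by
    rw [Finset.sum_range_tsub (hmono ω), h0, tsub_zero]
  rw [hsum]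
  refine Measurable.comap_le ?_
  refine Finset.measurable_sum _ fun i hi => ?_
  exact (comap_measurable _).mono (le_iSup₂_of_le i ((Finset.mem_range.1 hi).trans_le hj) le_rfl)
    le_rfl

variable [IsFiniteMeasure μ]

theorem measureReal_inter_eq_mul_of_measurableSet_sup {m₁ m₂ : MeasurableSpace Ω} (h₁ : m₁ ≤ mΩ)
    (h₂ : m₂ ≤ mΩ) {G Z : Set Ω} {c : ℝ} (hc : 0 ≤ c)
    (h : ∀ A D, MeasurableSet[m₁] A → MeasurableSet[m₂] D →
      μ.real (A ∩ D ∩ G) = μ.real (A ∩ D ∩ Z) * c) {E : Set Ω} (hE : MeasurableSet[m₁ ⊔ m₂] E) :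
    μ.real (E ∩ G) = μ.real (E ∩ Z) * c := by
  set C : Set (Set Ω) := image2 (· ∩ ·) {A | MeasurableSet[m₁] A} {D | MeasurableSet[m₂] D}
  have hpi : IsPiSystem C := by
    rintro _ ⟨A, hA, D, hD, rfl⟩ _ ⟨A', hA', D', hD', rfl⟩ -
    exact ⟨A ∩ A', MeasurableSet.inter hA hA', D ∩ D', MeasurableSet.inter hD hD',
      inter_inter_inter_comm ..⟩
  have hgen : m₁ ⊔ m₂ = MeasurableSpace.generateFrom C := by
    refine le_antisymm (sup_le (fun A hA => ?_) (fun D hD => ?_))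
      (MeasurableSpace.generateFrom_le ?_)
    · exact MeasurableSpace.measurableSet_generateFrom
        ⟨A, hA, univ, MeasurableSet.univ, inter_univ A⟩
    · exact MeasurableSpace.measurableSet_generateFrom
        ⟨univ, MeasurableSet.univ, D, hD, univ_inter D⟩
    · rintro _ ⟨A, hA, D, hD, rfl⟩
      exact MeasurableSet.inter ((le_sup_left : m₁ ≤ m₁ ⊔ m₂) _ hA)
        ((le_sup_right : m₂ ≤ m₁ ⊔ m₂) _ hD)
  have hreal {E : Set Ω} (hE : MeasurableSet[mΩ] E) :
      μ.restrict G E = (c.toNNReal • μ.restrict Z) E ↔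
        μ.real (E ∩ G) = μ.real (E ∩ Z) * c := by
    rw [← measureReal_eq_measureReal_iff, measureReal_restrict_apply hE,
      measureReal_nnreal_smul_apply, measureReal_restrict_apply hE, Real.coe_toNNReal c hc,
      mul_comm c]
  refine (hreal (sup_le h₁ h₂ _ hE)).1 (ext_on_measurableSpace_of_generate_finite mΩ C ?_
    (sup_le h₁ h₂) hgen hpi ?_ hE)
  · rintro _ ⟨A, hA, D, hD, rfl⟩
    exact (hreal ((h₁ A hA).inter (h₂ D hD))).2 (h A D hA hD)
  · have huniv := h univ univ MeasurableSet.univ MeasurableSet.univ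
    rw [univ_inter] at huniv
    exact (hreal MeasurableSet.univ).2 huniv

theorem IsSampledChain.of_indep {S : Type*} [MeasurableSpace S] [MeasurableSingletonClass S]
    [Fintype S] {P : Matrix S S ℝ} {q : ℝ} {𝒳 𝒩 : Filtration ℕ mΩ} {Y : ℕ → Ω → S}
    {B : ℕ → Set Ω} (hP : ∀ a i, 0 ≤ P a i) (hq : 0 ≤ q) (hindep : ∀ k, Indep (𝒳 k) (𝒩 k) μ)
    (hY : ∀ k, Measurable[𝒳 k] (Y k))
    (hmarkov : ∀ k A, MeasurableSet[𝒳 k] A → ∀ a i,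
      μ.real (A ∩ Y k ⁻¹' {a} ∩ Y (k + 1) ⁻¹' {i}) = μ.real (A ∩ Y k ⁻¹' {a}) * P a i)
    (hB : ∀ k, MeasurableSet[𝒩 (k + 1)] (B k))
    (hobs : ∀ k D, MeasurableSet[𝒩 k] D → μ.real (D \ B k) = μ.real D * q) :
    IsSampledChain P q (𝒳 ⊔ 𝒩) Y B μ := by
  have hmul : ∀ {k A D}, MeasurableSet[𝒳 k] A → MeasurableSet[𝒩 k] D →
      μ.real (A ∩ D) = μ.real A * μ.real D := fun {k A D} hA hD => by
    simp only [measureReal_def, (Indep_iff _ _ μ).1 (hindep k) A D hA hD, ENNReal.toReal_mul]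
  have hfib : ∀ {j k}, j ≤ k → ∀ a, MeasurableSet[𝒳 k] (Y j ⁻¹' {a}) := fun {j k} hjk a =>
    𝒳.mono hjk _ (hY j (measurableSet_singleton a))
  refine ⟨fun k => (hY k).mono le_sup_left le_rfl,
    fun k => (le_sup_right : 𝒩 (k + 1) ≤ 𝒳 (k + 1) ⊔ 𝒩 (k + 1)) _ (hB k),
    fun k E hE a i => ?_, fun k E hE a i => ?_⟩
  · rw [inter_assoc]
    refine measureReal_inter_eq_mul_of_measurableSet_sup (𝒳.le k) (𝒩.le k) (hP a i) ?_ hE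
    intro A D hA hD
    have hA' := hA.inter (hfib le_rfl a)
    rw [← inter_assoc, inter_right_comm A D, inter_right_comm _ D, hmul hA' hD,
      hmul ((𝒳.mono k.le_succ _ hA').inter (hfib le_rfl i)) (𝒩.mono k.le_succ _ hD),
      hmarkov k A hA]
    ring
  · rw [inter_assoc, inter_sdiff_assoc, mul_assoc]
    refine measureReal_inter_eq_mul_of_measurableSet_sup (𝒳.le k) (𝒩.le k)
      (mul_nonneg (hP a i) hq) ?_ hE
    intro A D hA hD
    have hA' := hA.inter (hfib le_rfl a)
    have hset : A ∩ D ∩ ((Y k ⁻¹' {a} ∩ Y (k + 1) ⁻¹' {i}) \ B k) =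
        A ∩ Y k ⁻¹' {a} ∩ Y (k + 1) ⁻¹' {i} ∩ (D \ B k) := by
      ext ω
      simp only [mem_inter_iff, Set.mem_sdiff]
      tauto
    rw [hset, inter_right_comm A D, hmul hA' hD, hmul ((𝒳.mono k.le_succ _ hA').inter
      (hfib le_rfl i)) ((𝒩.mono k.le_succ _ hD).diff (hB k)), hmarkov k A hA, hobs k D hD]
    ring

end Independence

section GridChain

variable {K : ℕ} {Ω : Type*} [MeasurableSpace Ω] {Q : Matrix (Fin K) (Fin K) ℝ} {lam : ℝ≥0}
  {X : ℝ≥0 → Ω → Fin K} {N : ℝ≥0 → Ω → ℕ} {μ : Measure Ω}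

theorem IsCTMC.measureReal_forall_le_succ (h : IsCTMC Q X μ) {t : ℕ → ℝ≥0} (ht : Monotone t)
    (k : ℕ) (x : ℕ → Fin K) :
    μ.real {ω | ∀ j ≤ k + 1, X (t j) ω = x j} =
      μ.real {ω | ∀ j ≤ k, X (t j) ω = x j} *
        transition Q (t (k + 1) - t k) (x k) (x (k + 1)) := by
  have hprod : ∀ n : ℕ, μ.real {ω | ∀ j ≤ n, X (t j) ω = x j} =
      μ.real {ω | X (t 0) ω = x 0} *
        ∏ j ∈ Finset.range n, transition Q (t (j + 1) - t j) (x j) (x (j + 1)) := fun n => by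
    have hn := h.markov n (fun j => t j) (fun _ _ hij => ht hij) fun j => x j
    simp only [Fin.forall_iff, Nat.lt_succ_iff] at hn
    rw [hn, ← Fin.prod_univ_eq_prod_range
      (fun j => transition Q (t (j + 1) - t j) (x j) (x (j + 1)))]
    rfl
  rw [hprod, hprod, Finset.prod_range_succ, mul_assoc]

theorem IsCTMC.measureReal_history_inter_succ (h : IsCTMC Q X μ) {t : ℕ → ℝ≥0} (ht : Monotone t)
    {k : ℕ} (z : Iic k → Fin K) (i : Fin K) :
    μ.real ((fun ω (j : Iic k) => X (t j) ω) ⁻¹' {z} ∩ X (t (k + 1)) ⁻¹' {i}) =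
      μ.real ((fun ω (j : Iic k) => X (t j) ω) ⁻¹' {z}) *
        transition Q (t (k + 1) - t k) (z ⟨k, mem_Iic.2 le_rfl⟩) i := by
  set x : ℕ → Fin K := fun j => if hj : j ≤ k then z ⟨j, hj⟩ else i with hx
  have hpast : (fun ω (j : Iic k) => X (t j) ω) ⁻¹' {z} = {ω | ∀ j ≤ k, X (t j) ω = x j} := by
    ext ω
    simp +contextual [hx, funext_iff]
  have hnext : (fun ω (j : Iic k) => X (t j) ω) ⁻¹' {z} ∩ X (t (k + 1)) ⁻¹' {i} =
      {ω | ∀ j ≤ k + 1, X (t j) ω = x j} := by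
    rw [hpast]
    ext ω
    simp only [mem_inter_iff, mem_ofPred_eq, Nat.le_succ_iff, or_imp, forall_and, forall_eq]
    simp [hx]
  rw [hnext, hpast, h.measureReal_forall_le_succ ht, hx]
  simp

theorem IsCTMC.measureReal_inter_succ [IsFiniteMeasure μ] (h : IsCTMC Q X μ) {t : ℕ → ℝ≥0}
    (ht : Monotone t) {k : ℕ} {A : Set Ω}
    (hA : MeasurableSet[Filtration.natural (fun j => X (t j))
      (fun j => (h.measurable (t j)).stronglyMeasurable) k] A) (a i : Fin K) :
    μ.real (A ∩ X (t k) ⁻¹' {a} ∩ X (t (k + 1)) ⁻¹' {i}) =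
      μ.real (A ∩ X (t k) ⁻¹' {a}) * transition Q (t (k + 1) - t k) a i := by
  set H : Ω → Iic k → Fin K := fun ω j => X (t j) ω
  have hH : Measurable H := measurable_pi_lambda _ fun j => h.measurable _
  rw [Filtration.natural_eq_comap] at hA
  obtain ⟨T, -, rfl⟩ := hA
  rw [measureReal_eq_sum_inter_preimage hH, measureReal_eq_sum_inter_preimage hH (_ ∩ _),
    Finset.sum_mul]
  refine Finset.sum_congr rfl fun z _ => ?_
  rw [inter_right_comm _ _ (H ⁻¹' {z})]
  by_cases hz : z ∈ T ∧ z ⟨k, mem_Iic.2 le_rfl⟩ = a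
  · have hpast : H ⁻¹' T ∩ X (t k) ⁻¹' {a} ∩ H ⁻¹' {z} = H ⁻¹' {z} :=
      inter_eq_right.2 <| by
        rintro ω rfl
        exact hz
    rw [hpast, h.measureReal_history_inter_succ ht, hz.2]
  · have hpast : H ⁻¹' T ∩ X (t k) ⁻¹' {a} ∩ H ⁻¹' {z} = ∅ :=
      eq_empty_of_forall_notMem <| by
        rintro ω ⟨hω, rfl⟩
        exact hz hω
    rw [hpast, empty_inter, measureReal_empty, zero_mul]

theorem IsPoissonProcess.measureReal_eq (h : IsPoissonProcess lam N μ) {s t : ℝ≥0} (hst : s ≤ t) :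
    μ.real {ω | N t ω = N s ω} = Real.exp (-(lam * (t - s))) := by
  have hmeas : Measurable fun ω => N t ω - N s ω := (h.measurable t).sub (h.measurable s)
  have hzero := poissonMeasure_real_singleton (lam * (t - s)) 0
  rw [← h.law s t hst, map_measureReal_apply hmeas (measurableSet_singleton 0)] at hzero
  simp only [pow_zero, mul_one, Nat.factorial_zero, Nat.cast_one, div_one, NNReal.coe_mul,
    NNReal.coe_sub hst] at hzero
  rw [← hzero]
  congr 1
  ext ω
  have hle : N s ω ≤ N t ω := h.monotone ω hst
  simp only [mem_ofPred_eq, mem_preimage, mem_singleton_iff]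
  omega

theorem IsPoissonProcess.measureReal_diff [IsFiniteMeasure μ] (h : IsPoissonProcess lam N μ)
    {t : ℕ → ℝ≥0} (ht : Monotone t) (ht0 : t 0 = 0) {k : ℕ} {D : Set Ω}
    (hD : MeasurableSet[Filtration.natural (fun j => N (t j))
      (fun j => (h.measurable (t j)).stronglyMeasurable) k] D) :
    μ.real (D \ {ω | N (t k) ω < N (t (k + 1)) ω}) =
      μ.real D * Real.exp (-(lam * (t (k + 1) - t k))) := by
  have hindep := indep_natural_increment (μ := μ) (fun j => h.measurable (t j))
    (fun ω => by rw [ht0, h.zero]) (fun ω => (h.monotone ω).comp ht)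
    (h.indepIncrements.nat ht) k
  have hmul := (Indep_iff _ _ μ).1 hindep D _ hD ⟨{0}, trivial, rfl⟩
  have hset : (fun ω => N (t (k + 1)) ω - N (t k) ω) ⁻¹' {0} =
      {ω | N (t (k + 1)) ω = N (t k) ω} := by
    ext ω
    have hle : N (t k) ω ≤ N (t (k + 1)) ω := h.monotone ω (ht k.le_succ)
    simp only [mem_ofPred_eq, mem_preimage, mem_singleton_iff]
    omega
  have hdiff : D \ {ω | N (t k) ω < N (t (k + 1)) ω} =
      D ∩ {ω | N (t (k + 1)) ω = N (t k) ω} := by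
    ext ω
    have hle : N (t k) ω ≤ N (t (k + 1)) ω := h.monotone ω (ht k.le_succ)
    simp only [mem_ofPred_eq, mem_inter_iff, Set.mem_sdiff, not_lt]
    exact and_congr_right fun _ => ⟨fun hge => hge.antisymm hle, fun heq => heq.le⟩
  rw [hset] at hmul
  rw [hdiff, ← h.measureReal_eq (ht k.le_succ), measureReal_def, hmul, ENNReal.toReal_mul]
  rfl

theorem IsPoissonSampled.exists_isSampledChain [IsFiniteMeasure μ]
    (h : IsPoissonSampled Q lam X N μ) (hQ : IsGenerator Q) (m : ℕ) :
    ∃ ℱ : Filtration ℕ ‹MeasurableSpace Ω›,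
      IsSampledChain (transition Q (m : ℝ)⁻¹) (Real.exp (-(lam * (m : ℝ)⁻¹))) ℱ
        (fun k => X (gridTime m k)) (fun k => {ω | N (gridTime m k) ω < N (gridTime m (k + 1)) ω})
        μ := by
  have hstep : ∀ k, ((gridTime m (k + 1) : ℝ) - gridTime m k) = (m : ℝ)⁻¹ := fun k => by
    simp only [gridTime]
    push_cast
    ring
  have hP := transition_mem_rowStochastic hQ (t := (m : ℝ)⁻¹) (by positivity)
  refine ⟨_, IsSampledChain.of_indep
    (𝒳 := .natural (fun k => X (gridTime m k)) fun k => (h.source.measurable _).stronglyMeasurable)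
    (𝒩 := .natural (fun k => N (gridTime m k)) fun k => (h.sampler.measurable _).stronglyMeasurable)
    (fun _ _ => Matrix.nonneg_of_mem_rowStochastic hP) (Real.exp_nonneg _) (fun k => ?_)
    (fun k => ?_) (fun k A hA a i => ?_) (fun k => ?_) (fun k D hD => ?_)⟩
  · refine indep_of_indep_of_le_left (indep_of_indep_of_le_right h.indep ?_) ?_
    · exact iSup₂_le fun j _ => Measurable.comap_le
        ((measurable_pi_apply _).comp (comap_measurable fun ω t => N t ω))
    · exact iSup₂_le fun j _ => Measurable.comap_le
        ((measurable_pi_apply _).comp (comap_measurable fun ω t => X t ω))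
  · exact measurable_natural _ le_rfl
  · rw [h.source.measureReal_inter_succ (gridTime_mono m) hA, hstep]
  · exact measurableSet_lt (measurable_natural _ k.le_succ) (measurable_natural _ le_rfl)
  · rw [h.sampler.measureReal_diff (gridTime_mono m) (by simp [gridTime]) hD, hstep]

end GridChain

section MeanFreshness

variable {ι : Type*} [Fintype ι] {π σ : ι → ℝ}

/-- The mean freshness, at sampling rate `lam`, of a source with stationary distribution `π` and
exit rates `σ`. -/
noncomputable def meanFreshness (π σ : ι → ℝ) (lam : ℝ) : ℝ :=
  1 - ∑ i, π i * σ i / (lam + σ i)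

theorem exists_pos_of_sum_eq_one (h1 : ∑ i, π i = 1) : ∃ i, 0 < π i := by
  by_contra! hle
  have hsum : ∑ i, π i ≤ 0 := Finset.sum_nonpos fun i _ => hle i
  linarith

theorem meanFreshness_eq_sum (h1 : ∑ i, π i = 1) {lam : ℝ} (hσ : ∀ i, lam + σ i ≠ 0) :
    meanFreshness π σ lam = ∑ i, lam * π i / (lam + σ i) := by
  rw [meanFreshness, ← h1, ← Finset.sum_sub_distrib]
  refine Finset.sum_congr rfl fun i _ => ?_
  have hi := hσ i
  field_simp
  ring

theorem meanFreshness_mem_Icc (h0 : ∀ i, 0 ≤ π i) (h1 : ∑ i, π i = 1) (hσ : ∀ i, 0 < σ i)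
    {lam : ℝ} (hlam : 0 ≤ lam) : meanFreshness π σ lam ∈ Icc (0 : ℝ) 1 := by
  have hpos : ∀ i, 0 < lam + σ i := fun i => add_pos_of_nonneg_of_pos hlam (hσ i)
  constructor
  · rw [meanFreshness_eq_sum h1 fun i => (hpos i).ne']
    exact Finset.sum_nonneg fun i _ => div_nonneg (mul_nonneg hlam (h0 i)) (hpos i).le
  · exact sub_le_self 1 (Finset.sum_nonneg fun i _ =>
      div_nonneg (mul_nonneg (h0 i) (hσ i).le) (hpos i).le)

theorem strictMonoOn_meanFreshness (h0 : ∀ i, 0 ≤ π i) (h1 : ∑ i, π i = 1) (hσ : ∀ i, 0 < σ i) :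
    StrictMonoOn (meanFreshness π σ) (Ioi 0) := by
  intro x hx y hy hxy
  obtain ⟨i, hi⟩ := exists_pos_of_sum_eq_one h1
  rw [mem_Ioi] at hx hy
  refine sub_lt_sub_left (Finset.sum_lt_sum (fun j _ => ?_) ⟨i, Finset.mem_univ i, ?_⟩) 1
  · have hj := h0 j
    have hσj := hσ j
    gcongr
  · have hσi := hσ i
    gcongr

theorem strictConvexOn_inv_add {s : ℝ} (hs : 0 < s) :
    StrictConvexOn ℝ (Ioi 0) fun x => (x + s)⁻¹ := by
  have h := ((strictConvexOn_zpow (m := -1) (by norm_num) (by norm_num)).translate_left s).subset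
    (s := Ioi 0) (fun x hx => add_pos hs (mem_Ioi.1 hx)) (convex_Ioi 0)
  simpa [Function.comp_def] using h

theorem strictConcaveOn_meanFreshness (h0 : ∀ i, 0 ≤ π i) (h1 : ∑ i, π i = 1)
    (hσ : ∀ i, 0 < σ i) : StrictConcaveOn ℝ (Ioi 0) (meanFreshness π σ) := by
  refine ⟨convex_Ioi 0, fun x hx y hy hxy a b ha hb hab => ?_⟩
  obtain ⟨i, hi⟩ := exists_pos_of_sum_eq_one h1
  have hinv : ∀ j, (a * x + b * y + σ j)⁻¹ < a * (x + σ j)⁻¹ + b * (y + σ j)⁻¹ := fun j =>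
    (strictConvexOn_inv_add (hσ j)).2 hx hy hxy ha hb hab
  have hlt : ∑ j, π j * σ j * (a * x + b * y + σ j)⁻¹ <
      ∑ j, π j * σ j * (a * (x + σ j)⁻¹ + b * (y + σ j)⁻¹) := by
    refine Finset.sum_lt_sum (fun j _ => ?_) ⟨i, Finset.mem_univ i, ?_⟩
    · exact mul_le_mul_of_nonneg_left (hinv j).le (mul_nonneg (h0 j) (hσ j).le)
    · exact mul_lt_mul_of_pos_left (hinv i) (mul_pos hi (hσ i))
  have hsum : ∑ j, π j * σ j * (a * (x + σ j)⁻¹ + b * (y + σ j)⁻¹) =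
      a * ∑ j, π j * σ j * (x + σ j)⁻¹ + b * ∑ j, π j * σ j * (y + σ j)⁻¹ := by
    rw [Finset.mul_sum, Finset.mul_sum, ← Finset.sum_add_distrib]
    exact Finset.sum_congr rfl fun j _ => by ring
  simp only [meanFreshness, smul_eq_mul, div_eq_mul_inv]
  rw [hsum] at hlt
  linarith

theorem contDiffOn_meanFreshness (hσ : ∀ i, 0 < σ i) :
    ContDiffOn ℝ 1 (meanFreshness π σ) (Ioi 0) := by
  refine contDiffOn_const.sub (ContDiffOn.sum fun i _ => contDiffOn_const.div
    (contDiffOn_id.add contDiffOn_const) fun x hx => ?_)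
  exact (add_pos hx (hσ i)).ne'

theorem tendsto_meanFreshness_zero (h1 : ∑ i, π i = 1) (hσ : ∀ i, 0 < σ i) :
    Tendsto (meanFreshness π σ) (𝓝[>] 0) (𝓝 0) := by
  have hcont : ContinuousAt (meanFreshness π σ) 0 := by
    refine continuousAt_const.sub (tendsto_finsetSum _ fun i _ => ?_)
    refine ContinuousAt.div continuousAt_const (continuousAt_id.add continuousAt_const) ?_
    simpa using (hσ i).ne'
  have hzero : meanFreshness π σ 0 = 0 := by
    rw [meanFreshness_eq_sum h1 fun i => by simpa using (hσ i).ne']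
    simp
  have hlim := hcont.tendsto
  rw [hzero] at hlim
  exact hlim.mono_left nhdsWithin_le_nhds

theorem tendsto_natCast_mul_one_sub {g : ℝ → ℝ} {g' : ℝ} (hg : HasDerivAt g g' 0) (h0 : g 0 = 1) :
    Tendsto (fun m : ℕ => (m : ℝ) * (1 - g (m : ℝ)⁻¹)) atTop (𝓝 (-g')) := by
  have hinv : Tendsto (fun m : ℕ => (m : ℝ)⁻¹) atTop (𝓝[≠] 0) := by
    refine tendsto_nhdsWithin_iff.2 ⟨tendsto_inv_atTop_nhds_zero_nat, ?_⟩
    filter_upwards [eventually_gt_atTop 0] with m hm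
    exact inv_ne_zero (Nat.cast_ne_zero.2 hm.ne')
  refine ((hg.tendsto_slope_zero.comp hinv).neg).congr fun m => ?_
  simp only [Function.comp_apply, inv_inv, zero_add, smul_eq_mul, h0]
  ring

theorem tendsto_sampledMean {K : ℕ} {Q : Matrix (Fin K) (Fin K) ℝ} (hQ : IsGenerator Q)
    {π : Fin K → ℝ} (h1 : ∑ i, π i = 1) {lam : ℝ} (hlam : 0 ≤ lam) :
    Tendsto (fun m : ℕ => sampledMean (transition Q (m : ℝ)⁻¹) π (Real.exp (-(lam * (m : ℝ)⁻¹))))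
      atTop (𝓝 (meanFreshness π (exitRate Q) lam)) := by
  have hne : ∀ i, lam + exitRate Q i ≠ 0 := fun i =>
    (add_pos_of_nonneg_of_pos hlam (exitRate_pos hQ i)).ne'
  rw [meanFreshness_eq_sum h1 hne]
  refine tendsto_finsetSum _ fun i _ => ?_
  have hexp : HasDerivAt (fun t : ℝ => Real.exp (-(lam * t))) (-lam) 0 := by
    simpa using (((hasDerivAt_id (0 : ℝ)).const_mul lam).neg).exp
  have hstay : HasDerivAt (fun t : ℝ => Real.exp (-(lam * t)) * transition Q t i i)
      (-(lam + exitRate Q i)) 0 := by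
    refine (hexp.mul (hasDerivAt_transition_apply_zero Q i i)).congr_deriv ?_
    rw [exitRate_eq_neg_diag hQ]
    simp [transition_zero, add_comm]
  have hnum := (tendsto_natCast_mul_one_sub hexp (by simp)).mul_const (π i)
  have hden := tendsto_natCast_mul_one_sub hstay (by simp [transition_zero])
  rw [neg_neg] at hnum hden
  refine (hnum.div hden (hne i)).congr' ?_
  filter_upwards [eventually_gt_atTop 0] with m hm
  have hm' : (m : ℝ) ≠ 0 := Nat.cast_ne_zero.2 hm.ne'
  rw [Pi.div_apply, mul_assoc, mul_div_mul_left _ _ hm']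

end MeanFreshness

section ContinuousTime

variable {K : ℕ} {Ω : Type*} [MeasurableSpace Ω] {Q : Matrix (Fin K) (Fin K) ℝ} {lam : ℝ≥0}
  {X : ℝ≥0 → Ω → Fin K} {N : ℝ≥0 → Ω → ℕ} {μ : Measure Ω}

/-- The event that the information is fresh at time `t`, for an initially stale observer. -/
def freshEvent (X : ℝ≥0 → Ω → Fin K) (N : ℝ≥0 → Ω → ℕ) (t : ℝ≥0) : Set Ω :=
  {ω | IsFresh (X · ω) (N · ω) false t}

/-- The event that the information is fresh at the first point after `t` of the grid of mesh
`1 / m`, when the source and the sampler are only known at the grid points. -/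
def gridFreshEvent (X : ℝ≥0 → Ω → Fin K) (N : ℝ≥0 → Ω → ℕ) (m : ℕ) (t : ℝ≥0) : Set Ω :=
  {ω | GridFresh (X · ω) (N · ω) m ⌈t * m⌉₊}

theorem IsPoissonSampled.eventually_mem_gridFreshEvent_iff (h : IsPoissonSampled Q lam X N μ)
    (t : ℝ≥0) (ω : Ω) : ∀ᶠ m in atTop, (ω ∈ gridFreshEvent X N m t ↔ ω ∈ freshEvent X N t) :=
  eventually_gridFresh_iff (h.source.rightContinuous ω) (h.sampler.monotone ω)
    (h.sampler.rightContinuous ω) t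

theorem tendsto_measureReal_of_eventually_mem_iff [IsFiniteMeasure μ] {E : ℕ → Set Ω} {F : Set Ω}
    (hE : ∀ m, MeasurableSet (E m)) (hlim : ∀ ω, ∀ᶠ m in atTop, (ω ∈ E m ↔ ω ∈ F)) :
    Tendsto (fun m => μ.real (E m)) atTop (𝓝 (μ.real F)) :=
  (ENNReal.tendsto_toReal (measure_ne_top μ F)).comp
    (tendsto_measure_of_tendsto_indicator_of_isFiniteMeasure atTop μ hE hlim)

section Measurability

variable [IsFiniteMeasure μ]

theorem IsPoissonSampled.measurableSet_gridFresh (h : IsPoissonSampled Q lam X N μ)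
    (hQ : IsGenerator Q) (m k : ℕ) : MeasurableSet {ω | GridFresh (X · ω) (N · ω) m k} := by
  obtain ⟨ℱ, hchain⟩ := h.exists_isSampledChain hQ m
  exact ℱ.le k _ (hchain.measurableSet_freshSet k)

theorem IsPoissonSampled.measurableSet_freshEvent_prod (h : IsPoissonSampled Q lam X N μ)
    (hQ : IsGenerator Q) : MeasurableSet {p : ℝ≥0 × Ω | p.2 ∈ freshEvent X N p.1} := by
  refine measurableSet_of_tendsto_indicator atTop (As := fun m : ℕ =>
    {p : ℝ≥0 × Ω | p.2 ∈ gridFreshEvent X N m p.1}) (fun m => ?_)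
    fun p => h.eventually_mem_gridFreshEvent_iff p.1 p.2
  have hceil : Measurable fun p : ℝ≥0 × Ω => ⌈p.1 * m⌉₊ :=
    Nat.measurable_ceil.comp (measurable_fst.mul_const _)
  have hset : MeasurableSet {p : ℕ × Ω | GridFresh (X · p.2) (N · p.2) m p.1} :=
    measurableSet_setOfPred.2 (measurable_from_prod_countable_right fun k =>
      measurableSet_setOfPred.1 (h.measurableSet_gridFresh hQ m k))
  exact (hceil.prodMk measurable_snd) hset

theorem IsPoissonSampled.measurableSet_freshEvent (h : IsPoissonSampled Q lam X N μ)
    (hQ : IsGenerator Q) (t : ℝ≥0) : MeasurableSet (freshEvent X N t) :=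
  measurable_prodMk_left (h.measurableSet_freshEvent_prod hQ)

end Measurability

variable [IsProbabilityMeasure μ] {π : Fin K → ℝ}

theorem IsPoissonSampled.exists_abs_measureReal_inter_gridFresh_sub_le
    (h : IsPoissonSampled Q lam X N μ) (hQ : IsGenerator Q) (hirr : IsIrreducible Q)
    (hπ : IsStationary Q π) (hlam : 0 < lam) :
    ∃ A c : ℝ, 0 ≤ A ∧ 0 < c ∧ ∀ m : ℕ, 0 < m → ∃ ℱ : Filtration ℕ ‹MeasurableSpace Ω›,
      (∀ k, MeasurableSet[ℱ k] {ω | GridFresh (X · ω) (N · ω) m k}) ∧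
      ∀ j E, MeasurableSet[ℱ j] E → ∀ k, j ≤ k →
        |μ.real (E ∩ {ω | GridFresh (X · ω) (N · ω) m k}) -
            sampledMean (transition Q (m : ℝ)⁻¹) π (Real.exp (-(lam * (m : ℝ)⁻¹))) * μ.real E| ≤
          A * Real.exp (-(c * (gridTime m k - gridTime m j))) := by
  obtain ⟨C, c, hC, hc, hmix⟩ := exists_abs_transition_sub_le hQ hirr hπ
  have hlam' : (0 : ℝ) < lam := hlam
  obtain ⟨c', hc'0, hc'c, hc'lam⟩ : ∃ c', 0 < c' ∧ c' ≤ c ∧ c' ≤ lam / 2 :=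
    ⟨min c (lam / 2), lt_min hc (half_pos hlam'), min_le_left _ _, min_le_right _ _⟩
  refine ⟨Fintype.card (Fin K) * (2 * C), c', by positivity, hc'0, fun m hm => ?_⟩
  obtain ⟨ℱ, hchain⟩ := h.exists_isSampledChain hQ m
  refine ⟨ℱ, hchain.measurableSet_freshSet, fun j E hE k hjk => ?_⟩
  obtain ⟨l, rfl⟩ := Nat.exists_eq_add_of_le hjk
  have hm' : (0 : ℝ) < (m : ℝ)⁻¹ := by positivity
  have hρ : ∀ l : ℕ, Real.exp (-(c' * (m : ℝ)⁻¹)) ^ l = Real.exp (-(c' * (l * (m : ℝ)⁻¹))) :=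
    fun l => by rw [← Real.exp_nat_mul]; ring_nf
  have hbound := hchain.abs_measureReal_freshSet_sub_le
    (ρ := Real.exp (-(c' * (m : ℝ)⁻¹))) (π := π) (C := C)
    (transition_mem_rowStochastic hQ hm'.le) (Real.exp_nonneg _)
    (Real.exp_lt_one_iff.2 (neg_neg_of_pos (by positivity))) ?_ (Real.exp_nonneg _)
    (Real.exp_le_one_iff.2 (neg_nonpos.2 (by positivity))) hC (fun l a i => ?_)
    hπ.nonneg hπ.sum_eq_one hE l
  · refine hbound.trans_eq ?_
    rw [hρ, ← mul_assoc]
    congr 4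
    simp only [gridTime]
    push_cast
    ring
  · have hle := mul_le_mul_of_nonneg_right hc'lam hm'.le
    rw [hρ, Real.exp_le_exp]
    push_cast
    linarith
  · rw [← transition_natCast_mul, hρ]
    refine (hmix _ (by positivity) a i).trans ?_
    gcongr

theorem IsPoissonSampled.exists_abs_measureReal_inter_freshEvent_sub_le
    (h : IsPoissonSampled Q lam X N μ) (hQ : IsGenerator Q) (hirr : IsIrreducible Q)
    (hπ : IsStationary Q π) (hlam : 0 < lam) :
    ∃ A c : ℝ, 0 ≤ A ∧ 0 < c ∧
      (∀ t, |μ.real (freshEvent X N t) - meanFreshness π (exitRate Q) lam| ≤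
        A * Real.exp (-(c * t))) ∧
      ∀ s t, s ≤ t →
        |μ.real (freshEvent X N s ∩ freshEvent X N t) -
            meanFreshness π (exitRate Q) lam * μ.real (freshEvent X N s)| ≤
          A * Real.exp (-(c * (t - s))) := by
  obtain ⟨A, c, hA, hc, hgrid⟩ :=
    h.exists_abs_measureReal_inter_gridFresh_sub_le hQ hirr hπ hlam
  choose! ℱ hℱ hbound using hgrid
  have hmeas (m : ℕ) (t : ℝ≥0) : MeasurableSet (gridFreshEvent X N m t) :=
    h.measurableSet_gridFresh hQ m _
  have hpass {E : ℕ → Set Ω} {F : Set Ω} {s t : ℝ≥0} (hst : s ≤ t)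
      (hE : ∀ m, MeasurableSet (E m)) (hEℱ : ∀ m, 0 < m → MeasurableSet[ℱ m ⌈s * m⌉₊] (E m))
      (hlim : ∀ ω, ∀ᶠ m in atTop, (ω ∈ E m ↔ ω ∈ F)) :
      |μ.real (F ∩ freshEvent X N t) - meanFreshness π (exitRate Q) lam * μ.real F| ≤
        A * Real.exp (-(c * (t - s))) := by
    have hinter : Tendsto (fun m => μ.real (E m ∩ gridFreshEvent X N m t)) atTop
        (𝓝 (μ.real (F ∩ freshEvent X N t))) :=
      tendsto_measureReal_of_eventually_mem_iff (fun m => (hE m).inter (hmeas m t)) fun ω => by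
        filter_upwards [hlim ω, h.eventually_mem_gridFreshEvent_iff t ω] with m hm hm'
        exact and_congr hm hm'
    have htime (u : ℝ≥0) : Tendsto (fun m : ℕ => (gridTime m ⌈u * m⌉₊ : ℝ)) atTop (𝓝 u) :=
      NNReal.tendsto_coe.2 (tendsto_nhdsWithin_iff.1 (tendsto_gridTime_natCeil u)).1
    refine le_of_tendsto_of_tendsto (hinter.sub ((tendsto_sampledMean hQ hπ.sum_eq_one
        lam.coe_nonneg).mul (tendsto_measureReal_of_eventually_mem_iff hE hlim))).abs
      ((Real.continuous_exp.tendsto _).comp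
        (((htime t).sub (htime s)).const_mul c).neg |>.const_mul A) ?_
    filter_upwards [eventually_gt_atTop 0] with m hm
    exact hbound m hm _ _ (hEℱ m hm) _ (by gcongr)
  refine ⟨A, c, hA, hc, fun t => ?_, fun s t hst => ?_⟩
  · simpa using hpass (E := fun _ => univ) (F := univ) (zero_le (a := t))
      (fun _ => MeasurableSet.univ) (fun _ _ => MeasurableSet.univ) fun _ => by simp
  · exact hpass hst (fun m => hmeas m s) (fun m hm => hℱ m hm _)
      (h.eventually_mem_gridFreshEvent_iff s)

end ContinuousTime

section TimeAverage

theorem integral_exp_neg_mul_abs {c : ℝ} (hc : 0 < c) : ∫ x : ℝ, Real.exp (-(c * |x|)) = 2 / c := by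
  rw [integral_comp_abs (f := fun x => Real.exp (-(c * x)))]
  simp_rw [← neg_mul]
  rw [integral_exp_mul_Ioi (neg_neg_of_pos hc)]
  simp [div_eq_mul_inv]

theorem integrable_exp_neg_mul_abs {c : ℝ} (hc : 0 < c) :
    Integrable fun x : ℝ => Real.exp (-(c * |x|)) :=
  not_imp_comm.1 integral_undef (by rw [integral_exp_neg_mul_abs hc]; positivity)

theorem setIntegral_exp_neg_mul_abs_sub_le {c : ℝ} (hc : 0 < c) (s : ℝ) (E : Set ℝ) :
    ∫ t in E, Real.exp (-(c * |t - s|)) ≤ 2 / c :=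
  (setIntegral_le_integral ((integrable_exp_neg_mul_abs hc).comp_sub_right s)
    (ae_of_all _ fun _ => Real.exp_nonneg _)).trans_eq
    ((integral_sub_right_eq_self (fun x => Real.exp (-(c * |x|))) s).trans
      (integral_exp_neg_mul_abs hc))

variable {Ω : Type*} [MeasurableSpace Ω] {μ : Measure Ω}

theorem integral_sq_integral_eq [IsFiniteMeasure μ] {α : Type*} [MeasurableSpace α] {ν : Measure α}
    [IsFiniteMeasure ν] {Y : α → Ω → ℝ} {M : ℝ} (hY : Measurable (Function.uncurry Y))
    (hM : ∀ t ω, |Y t ω| ≤ M) :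
    ∫ ω, (∫ t, Y t ω ∂ν) ^ 2 ∂μ = ∫ p : α × α, ∫ ω, Y p.1 ω * Y p.2 ω ∂μ ∂ν.prod ν := by
  have hmeas : Measurable fun z : Ω × α × α => Y z.2.1 z.1 * Y z.2.2 z.1 :=
    (hY.comp (measurable_snd.fst.prodMk measurable_fst)).mul
      (hY.comp (measurable_snd.snd.prodMk measurable_fst))
  have hint : Integrable (fun z : Ω × α × α => Y z.2.1 z.1 * Y z.2.2 z.1) (μ.prod (ν.prod ν)) :=
    Integrable.of_bound hmeas.aestronglyMeasurable (M * M) (ae_of_all _ fun z => by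
      rw [norm_mul]
      exact mul_le_mul (hM _ _) (hM _ _) (norm_nonneg _) ((abs_nonneg _).trans (hM z.2.1 z.1)))
  have hprod : ∀ ω, (∫ t, Y t ω ∂ν) ^ 2 = ∫ p : α × α, Y p.1 ω * Y p.2 ω ∂ν.prod ν := fun ω => by
    rw [integral_prod_mul (fun t => Y t ω) fun t => Y t ω, sq]
  simp_rw [hprod]
  exact integral_integral_swap (f := fun ω (p : α × α) => Y p.1 ω * Y p.2 ω) hint

theorem integral_sq_setIntegral_le [IsFiniteMeasure μ] {Y : ℝ → Ω → ℝ} {M A c : ℝ}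
    (hY : Measurable (Function.uncurry Y)) (hM : ∀ t ω, |Y t ω| ≤ M) (hA : 0 ≤ A) (hc : 0 < c)
    {E : Set ℝ} (hE : MeasurableSet E) (hfin : volume E ≠ ∞)
    (hcorr : ∀ s ∈ E, ∀ t ∈ E, |∫ ω, Y s ω * Y t ω ∂μ| ≤ A * Real.exp (-(c * |t - s|))) :
    ∫ ω, (∫ t in E, Y t ω) ^ 2 ∂μ ≤ A * (2 / c) * volume.real E := by
  have : Fact (volume E < ∞) := ⟨hfin.lt_top⟩
  have hexp : Integrable (fun p : ℝ × ℝ => A * Real.exp (-(c * |p.2 - p.1|)))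
      ((volume.restrict E).prod (volume.restrict E)) := by
    refine Integrable.of_bound (Continuous.aestronglyMeasurable (by fun_prop)) A
      (ae_of_all _ fun p => ?_)
    rw [Real.norm_of_nonneg (by positivity)]
    exact mul_le_of_le_one_right hA (Real.exp_le_one_iff.2 (neg_nonpos.2 (by positivity)))
  rw [integral_sq_integral_eq hY hM]
  calc ∫ p : ℝ × ℝ, ∫ ω, Y p.1 ω * Y p.2 ω ∂μ ∂(volume.restrict E).prod (volume.restrict E)
      ≤ ∫ p : ℝ × ℝ, A * Real.exp (-(c * |p.2 - p.1|))
          ∂(volume.restrict E).prod (volume.restrict E) := by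
        refine (le_abs_self _).trans (norm_integral_le_of_norm_le
          (f := fun p : ℝ × ℝ => ∫ ω, Y p.1 ω * Y p.2 ω ∂μ) hexp ?_)
        rw [Measure.prod_restrict]
        filter_upwards [ae_restrict_mem (hE.prod hE)] with p hp
        exact hcorr p.1 hp.1 p.2 hp.2
    _ = ∫ s in E, A * ∫ t in E, Real.exp (-(c * |t - s|)) := by
        rw [integral_prod _ hexp]
        simp_rw [integral_const_mul]
    _ ≤ ∫ _ in E, A * (2 / c) := by
        refine integral_mono_of_nonneg (ae_of_all _ fun s => ?_) (integrable_const _)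
          (ae_of_all _ fun s => ?_)
        · exact mul_nonneg hA (integral_nonneg fun t => Real.exp_nonneg _)
        · exact mul_le_mul_of_nonneg_left (setIntegral_exp_neg_mul_abs_sub_le hc s E) hA
    _ = A * (2 / c) * volume.real E := by
        rw [setIntegral_const, smul_eq_mul, mul_comm]

theorem ae_tendsto_zero_of_summable_integral_sq {J : ℕ → Ω → ℝ} (hJ : ∀ n, Measurable (J n))
    (hint : ∀ n, Integrable (fun ω => J n ω ^ 2) μ)
    (hsum : Summable fun n => ∫ ω, J n ω ^ 2 ∂μ) :
    ∀ᵐ ω ∂μ, Tendsto (fun n => J n ω) atTop (𝓝 0) := by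
  have hmeas : ∀ n, Measurable fun ω => ENNReal.ofReal (J n ω ^ 2) := fun n =>
    ((hJ n).pow_const 2).ennreal_ofReal
  have hfin : ∫⁻ ω, ∑' n, ENNReal.ofReal (J n ω ^ 2) ∂μ ≠ ∞ := by
    rw [lintegral_tsum fun n => (hmeas n).aemeasurable]
    simp_rw [← fun n => ofReal_integral_eq_lintegral_ofReal (hint n)
      (ae_of_all _ fun ω => sq_nonneg (J n ω))]
    exact hsum.tsum_ofReal_ne_top
  filter_upwards [ae_lt_top (Measurable.tsum hmeas) hfin] with ω hω
  have hsq : Tendsto (fun n => J n ω ^ 2) atTop (𝓝 0) := by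
    have hlim := (ENNReal.tendsto_toReal ENNReal.zero_ne_top).comp
      (ENNReal.tendsto_atTop_zero_of_tsum_ne_top hω.ne)
    exact hlim.congr fun n => ENNReal.toReal_ofReal (sq_nonneg _)
  have hsqrt := hsq.sqrt
  rw [Real.sqrt_zero] at hsqrt
  exact (tendsto_zero_iff_abs_tendsto_zero _).2 (hsqrt.congr fun n => Real.sqrt_sq_eq_abs _)

theorem tendsto_inv_mul_of_tendsto_sq {I : ℝ → ℝ} {M : ℝ} (hI : ∀ s t, |I t - I s| ≤ M * |t - s|)
    (hlim : Tendsto (fun n : ℕ => ((n : ℝ) ^ 2)⁻¹ * I (n ^ 2)) atTop (𝓝 0)) :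
    Tendsto (fun T => T⁻¹ * I T) atTop (𝓝 0) := by
  have hM : 0 ≤ M := by simpa using (abs_nonneg _).trans (hI 0 1)
  have hbound : Tendsto (fun n : ℕ => |((n : ℝ) ^ 2)⁻¹ * I (n ^ 2)| + M * (3 / n)) atTop (𝓝 0) := by
    simpa using hlim.abs.add ((tendsto_const_div_atTop_nhds_zero_nat 3).const_mul M)
  refine squeeze_zero_norm' ?_ (hbound.comp (tendsto_nat_floor_atTop.comp Real.tendsto_sqrt_atTop))
  filter_upwards [eventually_ge_atTop 1] with T hT
  set n := ⌊√T⌋₊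
  have hn1 : (1 : ℝ) ≤ n := by
    exact_mod_cast Nat.le_floor (by simpa using hT)
  have hsq : √T ^ 2 = T := Real.sq_sqrt (by linarith)
  have hnT : (n : ℝ) ^ 2 ≤ T := by
    rw [← hsq]
    gcongr
    exact Nat.floor_le (Real.sqrt_nonneg T)
  have hTn : T - n ^ 2 ≤ 3 * n := by
    have hlt : √T < n + 1 := Nat.lt_floor_add_one _
    have : T < (n + 1) ^ 2 := by rw [← hsq]; gcongr
    nlinarith
  have hIT : |I T| ≤ |I (n ^ 2)| + M * (3 * n) := by
    have := hI (n ^ 2) T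
    rw [abs_of_nonneg (sub_nonneg.2 hnT)] at this
    have := mul_le_mul_of_nonneg_left hTn hM
    linarith [abs_sub_abs_le_abs_sub (I T) (I (n ^ 2))]
  calc ‖T⁻¹ * I T‖ = T⁻¹ * |I T| := by
        rw [norm_mul, Real.norm_of_nonneg (by positivity), Real.norm_eq_abs]
    _ ≤ ((n : ℝ) ^ 2)⁻¹ * (|I (n ^ 2)| + M * (3 * n)) := by gcongr
    _ = |((n : ℝ) ^ 2)⁻¹ * I (n ^ 2)| + M * (3 / n) := by
        rw [abs_mul, abs_of_nonneg (a := ((n : ℝ) ^ 2)⁻¹) (by positivity)]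
        field_simp

section DecayingCorrelations

variable [IsFiniteMeasure μ] {Y : ℝ → Ω → ℝ} {M A c : ℝ}

theorem measurable_intervalIntegral_of_uncurry (hY : Measurable (Function.uncurry Y)) (s t : ℝ) :
    Measurable fun ω => ∫ u in s..t, Y u ω :=
  ((hY.stronglyMeasurable.integral_prod_left (f := Y)).sub
    (hY.stronglyMeasurable.integral_prod_left (f := Y))).measurable

theorem integral_sq_timeAverage_le (hY : Measurable (Function.uncurry Y))
    (hM : ∀ t ω, |Y t ω| ≤ M) (hA : 0 ≤ A) (hc : 0 < c)
    (hcorr : ∀ s t, 0 ≤ s → 0 ≤ t → |∫ ω, Y s ω * Y t ω ∂μ| ≤ A * Real.exp (-(c * |t - s|)))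
    {T : ℝ} (hT : 0 ≤ T) :
    ∫ ω, (T⁻¹ * ∫ t in (0 : ℝ)..T, Y t ω) ^ 2 ∂μ ≤ A * (2 / c) * T⁻¹ := by
  have hmoment := integral_sq_setIntegral_le hY hM hA hc (measurableSet_Ioc (a := 0) (b := T))
    measure_Ioc_lt_top.ne fun s hs t ht => hcorr s t hs.1.le ht.1.le
  rw [Real.volume_real_Ioc_of_le hT, sub_zero] at hmoment
  simp_rw [intervalIntegral.integral_of_le hT, mul_pow, integral_const_mul]
  refine (mul_le_mul_of_nonneg_left hmoment (by positivity)).trans_eq ?_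
  rcases eq_or_ne T 0 with rfl | hT0
  · simp
  · field_simp

theorem ae_tendsto_timeAverage_zero (hY : Measurable (Function.uncurry Y))
    (hM : ∀ t ω, |Y t ω| ≤ M) (hA : 0 ≤ A) (hc : 0 < c)
    (hcorr : ∀ s t, 0 ≤ s → 0 ≤ t → |∫ ω, Y s ω * Y t ω ∂μ| ≤ A * Real.exp (-(c * |t - s|))) :
    ∀ᵐ ω ∂μ, Tendsto (fun T : ℝ => T⁻¹ * ∫ t in (0 : ℝ)..T, Y t ω) atTop (𝓝 0) := by
  have hpath : ∀ ω s t, IntervalIntegrable (fun t => Y t ω) volume s t := fun ω s t =>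
    (intervalIntegrable_const (c := M)).mono_fun
      (hY.comp measurable_prodMk_right).aestronglyMeasurable
      (ae_of_all _ fun t => (hM t ω).trans (le_abs_self M))
  have hincr : ∀ ω s t, |∫ u in s..t, Y u ω| ≤ M * |t - s| := fun ω s t =>
    intervalIntegral.norm_integral_le_of_norm_le_const (f := fun u => Y u ω) fun u _ => hM u ω
  have hmeas : ∀ T : ℝ, Measurable fun ω => T⁻¹ * ∫ t in (0 : ℝ)..T, Y t ω := fun T =>
    (measurable_intervalIntegral_of_uncurry hY 0 T).const_mul _
  have hint : ∀ T : ℝ, Integrable (fun ω => (T⁻¹ * ∫ t in (0 : ℝ)..T, Y t ω) ^ 2) μ := fun T => by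
    refine Integrable.of_bound ((hmeas T).pow_const 2).aestronglyMeasurable (M ^ 2)
      (ae_of_all _ fun ω => ?_)
    rw [norm_pow, norm_mul, norm_inv]
    gcongr
    refine inv_mul_le_of_le_mul₀ (norm_nonneg T) ((abs_nonneg _).trans (hM 0 ω)) ?_
    simpa [mul_comm] using hincr ω 0 T
  have hsum : Summable fun n : ℕ => A * (2 / c) * ((n : ℝ) ^ 2)⁻¹ :=
    (Real.summable_nat_pow_inv.2 one_lt_two).mul_left _
  filter_upwards [ae_tendsto_zero_of_summable_integral_sq (fun n : ℕ => hmeas ((n : ℝ) ^ 2))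
    (fun n => hint _) (hsum.of_nonneg_of_le (fun n => integral_nonneg fun ω => sq_nonneg _)
      fun n => integral_sq_timeAverage_le hY hM hA hc hcorr (sq_nonneg _))] with ω hω
  refine tendsto_inv_mul_of_tendsto_sq (M := M) (fun s t => ?_) hω
  rw [intervalIntegral.integral_interval_sub_left (hpath ω 0 t) (hpath ω 0 s)]
  exact hincr ω s t

end DecayingCorrelations

end TimeAverage

section StaleStart

theorem intervalIntegrable_indicator_one {S : Set ℝ} (hS : MeasurableSet S) (s t : ℝ) :
    IntervalIntegrable (S.indicator (1 : ℝ → ℝ)) volume s t :=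
  ⟨(integrable_const (1 : ℝ)).indicator hS, (integrable_const (1 : ℝ)).indicator hS⟩

variable {Ω : Type*} [MeasurableSpace Ω] {μ : Measure Ω} [IsProbabilityMeasure μ]

theorem integral_mul_indicator_sub {E F : Set Ω} (hE : MeasurableSet E) (hF : MeasurableSet F)
    (f : ℝ) :
    ∫ ω, (E.indicator 1 ω - f) * (F.indicator 1 ω - f) ∂μ =
      (μ.real (E ∩ F) - f * μ.real E) - f * (μ.real F - f) := by
  have hint {G : Set Ω} (hG : MeasurableSet G) : Integrable (G.indicator (1 : Ω → ℝ)) μ :=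
    (integrable_const 1).indicator hG
  have hexpand : ∀ ω, (E.indicator 1 ω - f) * (F.indicator 1 ω - f) =
      (E ∩ F).indicator (1 : Ω → ℝ) ω - f * E.indicator (1 : Ω → ℝ) ω -
        f * (F.indicator (1 : Ω → ℝ) ω - f) := fun ω => by
    rw [inter_indicator_one, Pi.mul_apply]
    ring
  simp_rw [hexpand]
  rw [integral_sub, integral_sub, integral_const_mul, integral_const_mul, integral_sub,
    integral_indicator_one (hE.inter hF), integral_indicator_one hE, integral_indicator_one hF]
  · simp
  · exact hint hF
  · exact integrable_const f
  · exact hint (hE.inter hF)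
  · exact (hint hE).const_mul f
  · exact (hint (hE.inter hF)).sub ((hint hE).const_mul f)
  · exact ((hint hF).sub (integrable_const f)).const_mul f

variable {K : ℕ} {Q : Matrix (Fin K) (Fin K) ℝ} {lam : ℝ≥0} {X : ℝ≥0 → Ω → Fin K}
  {N : ℝ≥0 → Ω → ℕ} {π : Fin K → ℝ}

theorem IsPoissonSampled.exists_abs_integral_mul_indicator_freshEvent_sub_le
    (h : IsPoissonSampled Q lam X N μ) (hQ : IsGenerator Q) (hirr : IsIrreducible Q)
    (hπ : IsStationary Q π) (hlam : 0 < lam) :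
    ∃ A c : ℝ, 0 ≤ A ∧ 0 < c ∧ ∀ s t : ℝ≥0,
      |∫ ω, ((freshEvent X N s).indicator 1 ω - meanFreshness π (exitRate Q) lam) *
          ((freshEvent X N t).indicator 1 ω - meanFreshness π (exitRate Q) lam) ∂μ| ≤
        A * Real.exp (-(c * |(t : ℝ) - s|)) := by
  obtain ⟨A, c, hA, hc, hmean, hpair⟩ :=
    h.exists_abs_measureReal_inter_freshEvent_sub_le hQ hirr hπ hlam
  obtain ⟨hf0, hf1⟩ := meanFreshness_mem_Icc hπ.nonneg hπ.sum_eq_one (exitRate_pos hQ)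
    lam.coe_nonneg
  set f := meanFreshness π (exitRate Q) lam
  refine ⟨2 * A, c, by positivity, hc, fun s t => ?_⟩
  wlog hst : s ≤ t generalizing s t
  · simpa only [mul_comm, abs_sub_comm] using this t s (le_of_not_ge hst)
  have hst' : (0 : ℝ) ≤ t - s := sub_nonneg.2 hst
  rw [abs_of_nonneg hst', integral_mul_indicator_sub (h.measurableSet_freshEvent hQ s)
    (h.measurableSet_freshEvent hQ t)]
  have hfmean : |f * (μ.real (freshEvent X N t) - f)| ≤ A * Real.exp (-(c * (t - s))) :=
    calc |f * (μ.real (freshEvent X N t) - f)|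
        = f * |μ.real (freshEvent X N t) - f| := by rw [abs_mul, abs_of_nonneg hf0]
      _ ≤ |μ.real (freshEvent X N t) - f| := mul_le_of_le_one_left (abs_nonneg _) hf1
      _ ≤ A * Real.exp (-(c * t)) := hmean t
      _ ≤ A * Real.exp (-(c * (t - s))) := by
        gcongr
        exact sub_le_self _ s.coe_nonneg
  calc _ ≤ _ + _ := abs_sub _ _
    _ ≤ _ := add_le_add (hpair s t hst) hfmean
    _ = 2 * A * Real.exp (-(c * (t - s))) := by ring

theorem IsPoissonSampled.ae_tendsto_timeAverage_freshEvent
    (h : IsPoissonSampled Q lam X N μ) (hQ : IsGenerator Q) (hirr : IsIrreducible Q)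
    (hπ : IsStationary Q π) (hlam : 0 < lam) :
    ∀ᵐ ω ∂μ, Tendsto
      (fun T : ℝ => T⁻¹ * ∫ t in (0 : ℝ)..T, (freshEvent X N t.toNNReal).indicator 1 ω) atTop
      (𝓝 (meanFreshness π (exitRate Q) lam)) := by
  obtain ⟨A, c, hA, hc, hcorr⟩ :=
    h.exists_abs_integral_mul_indicator_freshEvent_sub_le hQ hirr hπ hlam
  obtain ⟨hf0, hf1⟩ := meanFreshness_mem_Icc hπ.nonneg hπ.sum_eq_one (exitRate_pos hQ)
    lam.coe_nonneg
  set f := meanFreshness π (exitRate Q) lam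
  have hprod : MeasurableSet {p : ℝ × Ω | p.2 ∈ freshEvent X N p.1.toNNReal} :=
    (h.measurableSet_freshEvent_prod hQ).preimage
      ((measurable_real_toNNReal.comp measurable_fst).prodMk measurable_snd)
  have hmeas : Measurable fun p : ℝ × Ω =>
      (freshEvent X N p.1.toNNReal).indicator (1 : Ω → ℝ) p.2 :=
    (measurable_const (a := (1 : ℝ))).indicator hprod
  have hint (ω : Ω) (T : ℝ) : IntervalIntegrable
      (fun t : ℝ => (freshEvent X N t.toNNReal).indicator (1 : Ω → ℝ) ω) volume 0 T :=
    intervalIntegrable_indicator_one (measurable_prodMk_right hprod) 0 T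
  have hbound (t : ℝ) (ω : Ω) :
      |(freshEvent X N t.toNNReal).indicator (1 : Ω → ℝ) ω - f| ≤ 1 := by
    rcases indicator_eq_zero_or_self (freshEvent X N t.toNNReal) (1 : Ω → ℝ) ω with h | h <;>
      rw [h, abs_le] <;> constructor <;> norm_num <;> linarith
  have hcov (s t : ℝ) (hs : 0 ≤ s) (ht : 0 ≤ t) :
      |∫ ω, ((freshEvent X N s.toNNReal).indicator 1 ω - f) *
        ((freshEvent X N t.toNNReal).indicator 1 ω - f) ∂μ| ≤ A * Real.exp (-(c * |t - s|)) := by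
    simpa only [Real.coe_toNNReal _ hs, Real.coe_toNNReal _ ht] using
      hcorr s.toNNReal t.toNNReal
  filter_upwards [ae_tendsto_timeAverage_zero
    (Y := fun t ω => (freshEvent X N t.toNNReal).indicator 1 ω - f)
    (hmeas.sub_const f) hbound hA hc hcov] with ω hω
  refine tendsto_sub_nhds_zero_iff.1 (hω.congr' ?_)
  filter_upwards [eventually_gt_atTop 0] with T hT
  rw [intervalIntegral.integral_sub (hint ω T) intervalIntegrable_const, mul_sub,
    intervalIntegral.integral_const, sub_zero, smul_eq_mul, inv_mul_cancel_left₀ hT.ne']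

end StaleStart

section InitialBit

variable {K : ℕ} {x : ℝ≥0 → Fin K} {n : ℝ≥0 → ℕ} {b : Bool} {t : ℝ≥0}

theorem IsFresh.of_false (h : IsFresh x n false t) : IsFresh x n b t :=
  h.imp_right fun hb => absurd hb.1 Bool.false_ne_true

theorem isFresh_iff_of_ne (hnr : ∀ t, ContinuousWithinAt n (Ici t) t) (hn : n 0 ≠ n t) :
    IsFresh x n b t ↔ IsFresh x n false t := by
  refine ⟨fun h => ?_, IsFresh.of_false⟩
  rcases h with h | ⟨-, hx⟩
  · exact Or.inl h
  · obtain ⟨s, hs, hjump⟩ : ∃ s ∈ Ioc 0 t, JumpsAt n s := by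
      by_contra! hconst
      exact hn ((forall_not_jumpsAt_iff hnr).1 hconst 0 ⟨le_rfl, zero_le⟩)
    exact Or.inl ⟨s, hs.2, hjump, fun u hu => hx u ⟨hs.1.trans hu.1, hu.2⟩⟩

theorem measurableSet_isFresh (hfalse : MeasurableSet {t | IsFresh x n false t}) (b : Bool) :
    MeasurableSet {t | IsFresh x n b t} := by
  have hinit : MeasurableSet {t | b = true ∧ ∀ u ∈ Ioc 0 t, ¬JumpsAt x u} :=
    OrdConnected.measurableSet ⟨fun _ hs _ ht _ hu =>
      ⟨hs.1, fun v hv => ht.2 v ⟨hv.1, hv.2.trans hu.2⟩⟩⟩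
  have hunion : {t | IsFresh x n b t} =
      {t | IsFresh x n false t} ∪ {t | b = true ∧ ∀ u ∈ Ioc 0 t, ¬JumpsAt x u} := by
    ext t
    simp [IsFresh]
  rw [hunion]
  exact hfalse.union hinit

theorem freshness_eq_one_iff {Ω : Type*} {X : ℝ≥0 → Ω → Fin K} {N : ℝ≥0 → Ω → ℕ}
    {b : Ω → Bool} {ω : Ω} : freshness X N b t ω = 1 ↔ IsFresh (X · ω) (N · ω) (b ω) t := by
  simp [freshness]

theorem tendsto_timeAverage_of_eqOn_Ici {f g : ℝ → ℝ} {T₀ m : ℝ}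
    (hf : ∀ s t, IntervalIntegrable f volume s t) (hg : ∀ s t, IntervalIntegrable g volume s t)
    (hfg : EqOn f g (Ici T₀))
    (hlim : Tendsto (fun T : ℝ => T⁻¹ * ∫ t in (0 : ℝ)..T, f t) atTop (𝓝 m)) :
    Tendsto (fun T : ℝ => T⁻¹ * ∫ t in (0 : ℝ)..T, g t) atTop (𝓝 m) := by
  have herr := tendsto_inv_atTop_zero.mul_const
    ((∫ t in (0 : ℝ)..T₀, g t) - ∫ t in (0 : ℝ)..T₀, f t)
  have hsum := herr.add hlim
  rw [zero_mul, zero_add] at hsum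
  refine hsum.congr' ?_
  filter_upwards [eventually_ge_atTop T₀] with T hT
  have htail : ∫ t in T₀..T, f t = ∫ t in T₀..T, g t :=
    intervalIntegral.integral_congr fun t ht => hfg (by rw [uIcc_of_le hT] at ht; exact ht.1)
  rw [← mul_add, ← intervalIntegral.integral_add_adjacent_intervals (hf 0 T₀) (hf T₀ T),
    ← intervalIntegral.integral_add_adjacent_intervals (hg 0 T₀) (hg T₀ T), htail]
  ring

variable {Ω : Type*} [MeasurableSpace Ω] {Q : Matrix (Fin K) (Fin K) ℝ} {lam : ℝ≥0}
  {X : ℝ≥0 → Ω → Fin K} {N : ℝ≥0 → Ω → ℕ} {μ : Measure Ω}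

theorem IsPoissonProcess.tendsto_measureReal_eq_zero (h : IsPoissonProcess lam N μ)
    (hlam : 0 < lam) : Tendsto (fun t : ℝ≥0 => μ.real {ω | N t ω = 0}) atTop (𝓝 0) := by
  have hexp (t : ℝ≥0) : μ.real {ω | N t ω = 0} = Real.exp (-(lam * t)) := by
    simpa [h.zero] using h.measureReal_eq (zero_le (a := t))
  simp_rw [hexp]
  exact Real.tendsto_exp_neg_atTop_nhds_zero.comp
    ((NNReal.tendsto_coe_atTop.2 tendsto_id).const_mul_atTop hlam)

theorem IsPoissonProcess.ae_exists_pos [IsFiniteMeasure μ] (h : IsPoissonProcess lam N μ)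
    (hlam : 0 < lam) : ∀ᵐ ω ∂μ, ∃ t : ℝ≥0, 0 < N t ω := by
  have hle (t : ℝ≥0) : μ.real {ω | ¬∃ t : ℝ≥0, 0 < N t ω} ≤ μ.real {ω | N t ω = 0} :=
    measureReal_mono fun ω hω => Nat.eq_zero_of_not_pos (not_exists.1 hω t)
  rw [ae_iff, ← measureReal_eq_zero_iff]
  exact le_antisymm (ge_of_tendsto' (h.tendsto_measureReal_eq_zero hlam) hle) measureReal_nonneg

theorem IsPoissonProcess.isFresh_iff_of_pos (h : IsPoissonProcess lam N μ) {x : ℝ≥0 → Fin K}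
    {b : Bool} {t : ℝ≥0} {ω : Ω} (hN : 0 < N t ω) :
    IsFresh x (N · ω) b t ↔ IsFresh x (N · ω) false t :=
  isFresh_iff_of_ne (h.rightContinuous ω) (by simpa [h.zero] using hN.ne)

variable [IsProbabilityMeasure μ] {π : Fin K → ℝ}

theorem IsPoissonSampled.ae_tendsto_timeAverage_freshness (h : IsPoissonSampled Q lam X N μ)
    (hQ : IsGenerator Q) (hirr : IsIrreducible Q) (hπ : IsStationary Q π) (hlam : 0 < lam)
    (b : Ω → Bool) :
    ∀ᵐ ω ∂μ, Tendsto (fun T : ℝ => T⁻¹ * ∫ t in (0 : ℝ)..T, freshness X N b t.toNNReal ω) atTop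
      (𝓝 (meanFreshness π (exitRate Q) lam)) := by
  filter_upwards [h.ae_tendsto_timeAverage_freshEvent hQ hirr hπ hlam,
    h.sampler.ae_exists_pos hlam] with ω hω ⟨T₀, hT₀⟩
  have hmeas : MeasurableSet {t | IsFresh (X · ω) (N · ω) false t} :=
    measurable_prodMk_right (h.measurableSet_freshEvent_prod hQ)
  refine tendsto_timeAverage_of_eqOn_Ici (T₀ := T₀)
    (intervalIntegrable_indicator_one (measurable_real_toNNReal hmeas))
    (intervalIntegrable_indicator_one
      (measurable_real_toNNReal (measurableSet_isFresh hmeas (b ω)))) (fun t ht => ?_) hω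
  have hpos : 0 < N t.toNNReal ω :=
    hT₀.trans_le (h.sampler.monotone ω (NNReal.le_toNNReal_of_coe_le ht))
  exact (indicator_const_eq_indicator_const (h.sampler.isFresh_iff_of_pos hpos)).symm

theorem IsPoissonSampled.tendsto_measureReal_freshness_eq_one (h : IsPoissonSampled Q lam X N μ)
    (hQ : IsGenerator Q) (hirr : IsIrreducible Q) (hπ : IsStationary Q π) (hlam : 0 < lam)
    (b : Ω → Bool) :
    Tendsto (fun t : ℝ≥0 => μ.real {ω | freshness X N b t ω = 1}) atTop
      (𝓝 (meanFreshness π (exitRate Q) lam)) := by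
  obtain ⟨A, c, -, hc, hmean, -⟩ :=
    h.exists_abs_measureReal_inter_freshEvent_sub_le hQ hirr hπ hlam
  have hstale : Tendsto (fun t : ℝ≥0 => μ.real (freshEvent X N t)) atTop
      (𝓝 (meanFreshness π (exitRate Q) lam)) := by
    refine tendsto_iff_dist_tendsto_zero.2 (squeeze_zero (fun _ => dist_nonneg) hmean ?_)
    simpa using (Real.tendsto_exp_neg_atTop_nhds_zero.comp
      ((NNReal.tendsto_coe_atTop.2 tendsto_id).const_mul_atTop hc)).const_mul A
  have hupper := hstale.add (h.sampler.tendsto_measureReal_eq_zero hlam)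
  rw [add_zero] at hupper
  simp only [freshness_eq_one_iff]
  refine tendsto_of_tendsto_of_tendsto_of_le_of_le hstale hupper
    (fun t => measureReal_mono fun ω => IsFresh.of_false)
    fun t => (measureReal_mono fun ω hω => ?_).trans (measureReal_union_le _ _)
  rcases Nat.eq_zero_or_pos (N t ω) with h0 | hpos
  · exact Or.inr h0
  · exact Or.inl ((h.sampler.isFresh_iff_of_pos hpos).1 hω)

theorem IsPoissonSampled.hasMeanFreshness (h : IsPoissonSampled Q lam X N μ)
    (hQ : IsGenerator Q) (hirr : IsIrreducible Q) (hπ : IsStationary Q π) (hlam : 0 < lam)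
    (b : Ω → Bool) :
    HasMeanFreshness μ (freshness X N b) (meanFreshness π (exitRate Q) lam) :=
  ⟨h.ae_tendsto_timeAverage_freshness hQ hirr hπ hlam b,
    h.tendsto_measureReal_freshness_eq_one hQ hirr hπ hlam b⟩

end InitialBit

end PoissonSampling

open PoissonSampling in
theorem theorem4 {K : ℕ} (Q : Matrix (Fin K) (Fin K) ℝ) (hQ : IsGenerator Q)
    (hirr : IsIrreducible Q) (π : Fin K → ℝ) (hπ : IsStationary Q π) :
    ∃ f : ℝ → ℝ,
      (∀ lam : ℝ≥0, 0 < lam →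
        ∀ (Ω : Type*) [MeasurableSpace Ω] (μ : Measure Ω) [IsProbabilityMeasure μ]
          (X : ℝ≥0 → Ω → Fin K) (N : ℝ≥0 → Ω → ℕ) (b : Ω → Bool),
          IsPoissonSampled Q lam X N μ → Measurable b →
            HasMeanFreshness μ (freshness X N b) (f lam)) ∧
      (∀ lam : ℝ, 0 < lam → f lam = 1 - ∑ i, (π i * exitRate Q i) / (lam + exitRate Q i)) ∧
      StrictMonoOn f (Ioi 0) ∧
      StrictConcaveOn ℝ (Ioi 0) f ∧
      DifferentiableOn ℝ f (Ioi 0) ∧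
      ContinuousOn (deriv f) (Ioi 0) ∧
      Tendsto f (𝓝[>] 0) (𝓝 0) := by
  have hσ := exitRate_pos hQ
  have hdiff := contDiffOn_meanFreshness (π := π) hσ
  exact ⟨meanFreshness π (exitRate Q),
    fun lam hlam Ω _ μ _ X N b h _ => h.hasMeanFreshness hQ hirr hπ hlam b,
    fun lam _ => rfl,
    strictMonoOn_meanFreshness hπ.nonneg hπ.sum_eq_one hσ,
    strictConcaveOn_meanFreshness hπ.nonneg hπ.sum_eq_one hσ,
    hdiff.differentiableOn one_ne_zero,
    hdiff.continuousOn_deriv_of_isOpen isOpen_Ioi le_rfl,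
    tendsto_meanFreshness_zero hπ.sum_eq_one hσ⟩
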